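/- Let $(X,d)$ be a complete separable geodesic metric space with a Borel measure $\mathfrak m$ that is finite on balls and has full support $\operatorname{supp}\mathfrak m=X$, and assume that $(X,d,\mathfrak m)$ is essentially non-branching: every dynamical optimal transport (for the squared distance) between two probability measures with finite second moment that are absolutely continuous with respect to $\mathfrak m$ is concentrated on a set $\Gamma$ of geodesics in which no two distinct members agree on an initial interval $[0,t]$, $0<t<1$. Let a compact Hausdorff topological group $G$ (for instance a compact Lie group) act continuously on $X$ by isometries that preserve $\mathfrak m$. Equip the orbit space $X^\ast=X/G$ with the distance between orbits, and let $\pi\colon X\to X^\ast$ be the projection. For closed subgroups $H\le K\le G$, the cone bundle over the orbit $G/K$ with fibre the cone over $K/H$ is the space $G\times_K\mathrm{Cone}(K/H)$ with its left $G$-action, that is, the bundle associated with $G\to G/K$, where $\mathrm{Cone}(F)$ is $F\times[0,1]$ or $F\times[0,\infty)$ with $F\times\{0\}$ collapsed to a point; in the first case its boundary is $G\times_K (K/H\times\{1\})$. No curvature bound is assumed. (a) If $X^\ast$ is isometric to $[-1,1]$, then there are points $x_\pm\in\pi^{-1}(\pm1)$ and $x_0\in\pi^{-1}(0)$, with isotropy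 groups $K_\pm$ and $H$, such that $H\le K_\pm$ and $X$ is $G$-equivariantly homeomorphic to the union of the two cone bundles $G\times_{K_\pm}\mathrm{Cone}(K_\pm/H)$ with fibres cones over $[0,1]$, glued along their boundaries by a $G$-equivariant homeomorphism; the zero section $[g,\text{apex}]$ of each corresponds to the orbit of $x_\pm$ by $[g,\text{apex}]\mapsto gx_\pm$. (b) If $X^\ast$ is isometric to $[0,\infty)$, then there are a point $x_+\in\pi^{-1}(0)$ with isotropy group $K$ and a point $x_0\in\pi^{-1}((0,\infty))$ with isotropy group $H\le K$ such that $X$ is $G$-equivariantly homeomorphic to the cone bundle $G\times_K\mathrm{Cone}(K/H)$ with infinite cones as fibres, its zero section corresponding to the orbit of $x_+$ by $[g,\text{apex}]\mapsto gx_+$. (c) If $X^\ast$ is isometric to the circle $\mathbb S^1$ of length $2\pi$ with its arc length distance, and $H$ is the isotropy group of any point of $X$, then $\pi\colon X\to\mathbb S^1$ is a locally trivial fibre bundle with fibre $G/H$ and structure group $N_G(H)/H$ (which acts on $G/H$ by $nH\cdot gH=gn^{-1}H$); the local trivializations can be taken $G$-equivariant. (d) If $X^\ast$ is isometric to $\mathbb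 R$, and $H$ is the isotropy group of any point of $X$, then $X$ is homeomorphic to $\mathbb R\times G/H$, $G$-equivariantly and over $X^\ast=\mathbb R$. -/

import Mathlib

open MeasureTheory Set Topology
open scoped unitInterval NNReal ENNReal

noncomputable section

/-! ## Geodesics, optimal transport and essentially non-branching spaces -/

/-- Constant speed minimizing geodesics `[0,1] → X`. The topology is the one induced by the
compact-open topology, that is, by uniform convergence. -/
def Geo (X : Type*) [MetricSpace X] : Type _ :=
  {γ : C(I, X) // ∀ s t : I, dist (γ s) (γ t) = |(s : ℝ) - (t : ℝ)| * dist (γ 0) (γ 1)}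

namespace Geo

variable {X : Type*} [MetricSpace X]

/-- Evaluation of a geodesic at time `t`. -/
def eval (γ : Geo X) (t : I) : X := γ.1 t

instance : TopologicalSpace (Geo X) :=
  inferInstanceAs (TopologicalSpace
    {γ : C(I, X) // ∀ s t : I, dist (γ s) (γ t) = |(s : ℝ) - (t : ℝ)| * dist (γ 0) (γ 1)})

instance : MeasurableSpace (Geo X) := borel _

instance : BorelSpace (Geo X) := ⟨rfl⟩

end Geo

/-- Any two points are joined by a minimizing geodesic. -/
def IsGeodesicSpace (X : Type*) [MetricSpace X] : Prop :=
  ∀ x y : X, ∃ γ : Geo X, γ.eval 0 = x ∧ γ.eval 1 = y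

/-- Borel probability measures with finite second moment. -/
def IsP2 {X : Type*} [MetricSpace X] [MeasurableSpace X] (μ : Measure X) : Prop :=
  IsProbabilityMeasure μ ∧ ∃ x₀ : X, ∫⁻ x, edist x x₀ ^ 2 ∂μ < ∞

/-- `ρ` is a coupling (transport plan) of `μ` and `ν`. -/
def IsCoupling {X : Type*} [MeasurableSpace X] (ρ : Measure (X × X)) (μ ν : Measure X) : Prop :=
  ρ.map Prod.fst = μ ∧ ρ.map Prod.snd = ν

/-- `ρ` is an optimal coupling of `μ` and `ν` for the squared distance. -/
def IsOptimalCoupling {X : Type*} [MetricSpace X] [MeasurableSpace X]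
    (ρ : Measure (X × X)) (μ ν : Measure X) : Prop :=
  IsCoupling ρ μ ν ∧
    ∀ ρ' : Measure (X × X), IsCoupling ρ' μ ν →
      ∫⁻ p, edist p.1 p.2 ^ 2 ∂ρ ≤ ∫⁻ p, edist p.1 p.2 ^ 2 ∂ρ'

/-- `η` is a dynamical optimal transport from `μ` to `ν`. -/
def IsOptGeo {X : Type*} [MetricSpace X] [MeasurableSpace X]
    (η : Measure (Geo X)) (μ ν : Measure X) : Prop :=
  IsProbabilityMeasure η ∧ IsOptimalCoupling (η.map fun γ => (γ.eval 0, γ.eval 1)) μ ν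

/-- A set of geodesics is non-branching if two members that agree on some initial interval
`[0,t]`, `0 < t < 1`, are equal. -/
def IsNonbranchingSet {X : Type*} [MetricSpace X] (Γ : Set (Geo X)) : Prop :=
  ∀ γ ∈ Γ, ∀ γ' ∈ Γ, ∀ t : I, 0 < t → t < 1 →
    (∀ s : I, s ≤ t → γ.eval s = γ'.eval s) → γ = γ'

/-- Every dynamical optimal transport between absolutely continuous measures with finite second
moment is concentrated on a set of non-branching geodesics. -/
def IsEssentiallyNonbranching {X : Type*} [MetricSpace X] [MeasurableSpace X]
    (m : Measure X) : Prop :=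
  ∀ μ ν : Measure X, IsP2 μ → IsP2 ν → μ ≪ m → ν ≪ m →
    ∀ η : Measure (Geo X), IsOptGeo η μ ν →
      ∃ Γ : Set (Geo X), IsNonbranchingSet Γ ∧ ∀ᵐ γ ∂η, γ ∈ Γ

/-! ## The orbit space -/

/-- The orbital distance `d*(p,q)`: the distance in `X` between the two orbits. -/
def orbitDist {G X : Type*} [Group G] [MetricSpace X] [MulAction G X]
    (p q : MulAction.orbitRel.Quotient G X) : ℝ :=
  ⨅ z : p.orbit × q.orbit, dist (z.1 : X) (z.2 : X)

/-- The projection `π : X → X/G`. -/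
def orbitProj (G : Type*) {X : Type*} [Group G] [MulAction G X] (x : X) :
    MulAction.orbitRel.Quotient G X :=
  Quotient.mk'' x

/-- Isometries from the orbit space with the orbital distance onto a metric space `Y`. -/
structure OrbitSpaceIsometry (G X Y : Type*) [Group G] [MetricSpace X] [MulAction G X]
    [MetricSpace Y] extends MulAction.orbitRel.Quotient G X ≃ Y where
  dist_eq' : ∀ p q, dist (toFun p) (toFun q) = orbitDist p q

/-- The composition `X → X/G → Y` of the orbit projection with an isometry `X/G → Y`. -/
def OrbitSpaceIsometry.proj {G X Y : Type*} [Group G] [MetricSpace X] [MulAction G X]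
    [MetricSpace Y] (f : OrbitSpaceIsometry G X Y) (x : X) : Y :=
  f.toEquiv (orbitProj G x)

/-! ## Cones and cone bundles -/

/-- The relation on `F × T` that collapses `F × {0}` to a point. -/
def coneSetoid (T F : Type*) [Zero T] : Setoid (F × T) where
  r p q := p = q ∨ (p.2 = 0 ∧ q.2 = 0)
  iseqv := by
    refine ⟨fun p => Or.inl rfl, ?_, ?_⟩
    · rintro p q (h | h)
      · exact Or.inl h.symm
      · exact Or.inr h.symm
    · rintro p q r (rfl | h) (rfl | h')
      · exact Or.inl rfl
      · exact Or.inr h'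
      · exact Or.inr h
      · exact Or.inr ⟨h.1, h'.2⟩

/-- The topological cone `(F × T) / (F × {0})`: the closed cone for `T = [0,1]`, the open
(infinite) cone for `T = [0,∞)`. -/
def TopCone (T F : Type*) [Zero T] : Type _ := Quotient (coneSetoid T F)

namespace TopCone

variable {T F : Type*} [Zero T]

/-- The class of `(y,t)`. -/
def mk (y : F) (t : T) : TopCone T F := Quotient.mk (coneSetoid T F) (y, t)

instance [TopologicalSpace T] [TopologicalSpace F] : TopologicalSpace (TopCone T F) :=
  inferInstanceAs (TopologicalSpace (Quotient (coneSetoid T F)))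

/-- The cone of an action: `k • [y,t] = [k • y,t]`. -/
instance {K : Type*} [Group K] [MulAction K F] : MulAction K (TopCone T F) where
  smul k := Quotient.map' (fun p => (k • p.1, p.2)) (by
    rintro p q (rfl | h)
    · exact Or.inl rfl
    · exact Or.inr h)
  one_smul := by
    rintro ⟨y, t⟩
    exact congrArg (fun z => mk z t) (one_smul K y)
  mul_smul := by
    rintro a b ⟨y, t⟩
    exact congrArg (fun z => mk z t) (mul_smul a b y)

end TopCone

/-- The relation `(g,a) ~ (g k⁻¹, k a)`, `k ∈ K`, on `G × A`. -/
def twistedSetoid {G : Type*} [Group G] (K : Subgroup G) (A : Type*) [MulAction K A] :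
    Setoid (G × A) where
  r p q := ∃ k : K, q.1 = p.1 * (k : G)⁻¹ ∧ q.2 = k • p.2
  iseqv := by
    refine ⟨fun p => ⟨1, by simp⟩, ?_, ?_⟩
    · rintro p q ⟨k, h1, h2⟩
      exact ⟨k⁻¹, by simp [h1], by simp [h2]⟩
    · rintro p q r ⟨k, h1, h2⟩ ⟨l, h3, h4⟩
      exact ⟨l * k, by simp [h1, h3, mul_assoc], by simp [h2, h4, mul_smul]⟩

/-- The associated bundle `G ×_K A` over `G/K`. -/
def TwistedProduct {G : Type*} [Group G] (K : Subgroup G) (A : Type*) [MulAction K A] : Type _ :=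
  Quotient (twistedSetoid K A)

namespace TwistedProduct

variable {G : Type*} [Group G] {K : Subgroup G} {A : Type*} [MulAction K A]

/-- The class `[g,a]`. -/
def mk (K : Subgroup G) [MulAction K A] (g : G) (a : A) : TwistedProduct K A :=
  Quotient.mk (twistedSetoid K A) (g, a)

instance [TopologicalSpace G] [TopologicalSpace A] : TopologicalSpace (TwistedProduct K A) :=
  inferInstanceAs (TopologicalSpace (Quotient (twistedSetoid K A)))

/-- The action `g' • [g,a] = [g' g,a]`. -/
instance : MulAction G (TwistedProduct K A) where
  smul g' := Quotient.map' (fun p => (g' * p.1, p.2)) (by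
    rintro p q ⟨k, h1, h2⟩
    exact ⟨k, by simp [h1, mul_assoc], h2⟩)
  one_smul := by
    rintro ⟨g, a⟩
    exact congrArg (fun z => mk K z a) (one_mul g)
  mul_smul := by
    rintro g₁ g₂ ⟨g, a⟩
    exact congrArg (fun z => mk K z a) (mul_assoc g₁ g₂ g)

end TwistedProduct

/-- The cone bundle `G ×_K Cone(K/H)` over the orbit `G/K`, with cone parameter in `T`. -/
abbrev ConeBundle {G : Type*} [Group G] (T : Type*) [Zero T] (K H : Subgroup G) : Type _ :=
  TwistedProduct K (TopCone T (K ⧸ H.subgroupOf K))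

/-- The point `[g,[kH,t]]` of the cone bundle. -/
def ConeBundle.mk {G : Type*} [Group G] {T : Type*} [Zero T] (K H : Subgroup G)
    (g : G) (y : K ⧸ H.subgroupOf K) (t : T) : ConeBundle T K H :=
  TwistedProduct.mk K g (TopCone.mk y t)

/-- The boundary `G ×_K (K/H × {1})` of a cone bundle with closed cones as fibres. -/
def ConeBundle.boundary {G : Type*} [Group G] (K H : Subgroup G) : Set (ConeBundle I K H) :=
  {z | ∃ (g : G) (y : K ⧸ H.subgroupOf K), z = ConeBundle.mk K H g y 1}

/-! ## Gluing -/

/-- The relation that identifies `s ∈ S ⊆ A` with `φ s ∈ S' ⊆ B`. -/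
def glueRel {A B : Type*} {S : Set A} {S' : Set B} (φ : S → S') (p q : A ⊕ B) : Prop :=
  ∃ s : S, p = Sum.inl (s : A) ∧ q = Sum.inr (φ s : B)

/-- The adjunction space `A ∪_φ B`. -/
def Glued {A B : Type*} {S : Set A} {S' : Set B} (φ : S → S') : Type _ := Quot (glueRel φ)

namespace Glued

variable {A B : Type*} {S : Set A} {S' : Set B}

instance [TopologicalSpace A] [TopologicalSpace B] (φ : S → S') : TopologicalSpace (Glued φ) :=
  inferInstanceAs (TopologicalSpace (Quot (glueRel φ)))

/-- The map `A → A ∪_φ B`. -/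
def inl (φ : S → S') (a : A) : Glued φ := Quot.mk _ (Sum.inl a)

/-- The map `B → A ∪_φ B`. -/
def inr (φ : S → S') (b : B) : Glued φ := Quot.mk _ (Sum.inr b)

end Glued

/-! ## Bundles with fibre `G/H` and structure group `N(H)/H` -/

/-- The group `N(H)/H`. -/
abbrev NormalizerQuotient {G : Type*} [Group G] (H : Subgroup G) : Type _ :=
  Subgroup.normalizer (H : Set G) ⧸ H.subgroupOf (Subgroup.normalizer (H : Set G))

/-- The action of `N(H)/H` on `G/H` given by `nH • gH = g n⁻¹ H`. -/
instance NormalizerQuotient.mulAction {G : Type*} [Group G] (H : Subgroup G) :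
    MulAction (NormalizerQuotient H) (G ⧸ H) where
  smul := Quotient.map₂ (fun n g => g * (n : G)⁻¹) (by
    intro n n' hn g g' hg
    change QuotientGroup.leftRel _ _ _ at hn hg ⊢
    rw [QuotientGroup.leftRel_apply] at hn hg ⊢
    rw [Subgroup.mem_subgroupOf] at hn
    have h1 : (n : G) * (g⁻¹ * g') * (n : G)⁻¹ ∈ H := (n.2 _).1 hg
    have h2 : (n : G) * ((n : G)⁻¹ * (n' : G))⁻¹ * (n : G)⁻¹ ∈ H := (n.2 _).1 (H.inv_mem hn)
    have h3 := H.mul_mem h1 h2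
    convert h3 using 1
    group)
  one_smul := by
    rintro ⟨g⟩
    exact congrArg (QuotientGroup.mk (s := H)) (by simp)
  mul_smul := by
    rintro ⟨a⟩ ⟨b⟩ ⟨g⟩
    exact congrArg (QuotientGroup.mk (s := H)) (by simp [mul_assoc])

/-- `p : X → B` is a locally trivial bundle with fibre `G/H` and structure group `N(H)/H`: it has
an atlas of local trivializations, each of them `G`-equivariant, such that every change of
trivialization is given by a continuous map from the overlap to `N(H)/H`. -/
def IsHomogeneousBundle {G X B : Type*} [Group G] [TopologicalSpace G] [TopologicalSpace X]
    [TopologicalSpace B] [MulAction G X] (H : Subgroup G) (p : X → B) : Prop :=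
  ∃ e : B → Bundle.Trivialization (G ⧸ H) p,
    (∀ b, b ∈ (e b).baseSet) ∧
    (∀ b (g : G) (x : X), x ∈ (e b).source → g • x ∈ (e b).source ∧
      (e b (g • x)).2 = g • (e b x).2) ∧
    ∀ a b, ∃ τ : B → NormalizerQuotient H,
      ContinuousOn τ ((e a).baseSet ∩ (e b).baseSet) ∧
      ∀ z ∈ (e a).baseSet ∩ (e b).baseSet, ∀ y : G ⧸ H,
        (e a).coordChange (e b) z y = τ z • y

end

/-!
The orbit projection `q : X → X/G` is a submetry whose fibres are compact orbits. A geodesic of `X`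
that realizes the distance between the orbits of its end points is called horizontal; it projects
isometrically to the orbit space. Everything rests on one fact
(`IsEssentiallyNonbranching.horizontal_eq`): two horizontal geodesics that agree on an initial piece
agree throughout.

For the proof, suppose `γ₁` and `γ₂` agree up to an interior time `s₀` and differ later. Pushing the
Haar measure of `G` along the orbits through `γ₁` or `γ₂` disintegrates `m`
(`map_inv_smul_absolutelyContinuous`), so a law of the parameter that is absolutely continuous with
respect to the image of `m` gives an absolutely continuous measure on `X`. Take such laws before and
after `s₀`, an optimal coupling `ρ` of them on the parameter interval, a `ρ`-random pair `(s,t)`, a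
Haar random `g`, and move from `g⁻¹ • γᵢ s` to `g⁻¹ • γᵢ t` along `g⁻¹ • γᵢ`, where `i` is decided
by a fair coin. This transport is optimal because the parameter is a 1-Lipschitz function on `X` and
`ρ` is optimal (`isOptGeo_of_lipschitz`). The pieces of `g⁻¹ • γ₁` and `g⁻¹ • γ₂` from `s` to `t`
agree up to `s₀`, so essential non-branching makes them equal almost surely, which contradicts
`γ₁ ≠ γ₂` since `m` has full support.

Extending geodesics backwards, it follows that a point over an interior parameter has a unique
nearest point on every other orbit of the interval (`IsEssentiallyNonbranching.lift_unique`). Hence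
there is a unique horizontal section through it; whatever fixes the point fixes the section
pointwise, so the isotropy group is constant over the interior and contained in the isotropy groups
at the ends (`IsEssentiallyNonbranching.exists_section`).

The rest is topology: `(g,t) ↦ g • γ t` is a proper map that descends to a cone bundle
(`isClosedEmbedding_coneBundleMap`) or to a product with `G/H` (`exists_homeomorph_of_section`). Two
sections over an overlap differ by a continuous map to `N(H)/H`
(`isHomogeneousBundle_of_sections`).
-/

/-! ### Optimal couplings on compact spaces -/

theorem exists_isOptimalCoupling {Z : Type*} [MetricSpace Z] [CompactSpace Z] [MeasurableSpace Z]
    [BorelSpace Z] (α β : Measure Z) [IsProbabilityMeasure α] [IsProbabilityMeasure β] :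
    ∃ ρ : Measure (Z × Z), IsProbabilityMeasure ρ ∧ IsOptimalCoupling ρ α β := by
  let C : Set (ProbabilityMeasure (Z × Z)) :=
    {ρ | ρ.map (f := Prod.fst) measurable_fst.aemeasurable = ⟨α, inferInstance⟩ ∧
      ρ.map (f := Prod.snd) measurable_snd.aemeasurable = ⟨β, inferInstance⟩}
  have hC : ∀ ρ : ProbabilityMeasure (Z × Z), ρ ∈ C ↔ IsCoupling (ρ : Measure (Z × Z)) α β :=
    fun ρ => and_congr Subtype.ext_iff Subtype.ext_iff
  have hclosed : IsClosed C :=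
    (isClosed_eq (ProbabilityMeasure.continuous_map continuous_fst) continuous_const).inter
      (isClosed_eq (ProbabilityMeasure.continuous_map continuous_snd) continuous_const)
  have hne : C.Nonempty :=
    ⟨⟨α.prod β, inferInstance⟩, (hC _).2 ⟨by simp, by simp⟩⟩
  let cost : C(Z × Z, ℝ≥0) := ⟨fun p => nndist p.1 p.2 ^ 2, by fun_prop⟩
  have hcost : ∀ ρ : Measure (Z × Z),
      ∫⁻ p, edist p.1 p.2 ^ 2 ∂ρ = ∫⁻ p, (cost p : ℝ≥0∞) ∂ρ := by
    intro ρ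
    refine lintegral_congr fun p => ?_
    simp [cost]
  obtain ⟨ρ, hρC, hρ⟩ := hclosed.isCompact.exists_isMinOn hne
    (ProbabilityMeasure.continuous_lintegral_continuousMap cost).continuousOn
  refine ⟨ρ, inferInstance, (hC ρ).1 hρC, fun ρ' hρ' => ?_⟩
  have : IsProbabilityMeasure ρ' := by
    constructor
    rw [← measure_univ (μ := α), ← hρ'.1, Measure.map_apply measurable_fst MeasurableSet.univ,
      preimage_univ]
  rw [hcost, hcost]
  exact hρ ((hC ⟨ρ', this⟩).2 hρ')

/-! ### Averaging over a compact group -/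

section Averaging

/-- The law of `g⁻¹ • x` for `θ`-random `g` depends on the orbit of `x` only. The inverse makes left
invariance of `θ` suffice. -/
theorem measure_inv_smul_mem_smul {G X : Type*} [Group G] [MeasurableSpace G] [MeasurableMul G]
    [MulAction G X] (θ : Measure G) [θ.IsMulLeftInvariant] (A : Set X) (h : G)
    (x : X) : θ {g | g⁻¹ • h • x ∈ A} = θ {g | g⁻¹ • x ∈ A} := by
  rw [← measure_preimage_mul θ h⁻¹ {g | g⁻¹ • x ∈ A}]
  congr 1
  ext g
  simp [mul_smul]

variable {G X : Type*} [Group G] [TopologicalSpace G] [IsTopologicalGroup G]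
  [MeasurableSpace G] [BorelSpace G]
  [MetricSpace X] [SecondCountableTopology X] [MeasurableSpace X] [BorelSpace X]
  [MulAction G X] [ContinuousSMul G X]

theorem measurable_inv_smul_prod : Measurable fun p : G × X => p.1⁻¹ • p.2 :=
  (continuous_fst.inv.smul continuous_snd).measurable

/-- If `ν` is absolutely continuous with respect to a `G`-invariant measure `m`, then averaging
over `G` does not charge `m`-null sets. -/
theorem ae_measure_inv_smul_mem_eq_zero (θ : Measure G) [SFinite θ] (m ν : Measure X)
    [SMulInvariantMeasure G X m] [SFinite ν] (hν : ν ≪ m) {A : Set X} (hA : MeasurableSet A)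
    (h0 : m A = 0) : ∀ᵐ x ∂ν, θ {g | g⁻¹ • x ∈ A} = 0 := by
  have hS : MeasurableSet {p : G × X | p.1⁻¹ • p.2 ∈ A} := measurable_inv_smul_prod hA
  have h : (θ.prod ν) {p : G × X | p.1⁻¹ • p.2 ∈ A} = 0 := by
    rw [Measure.measure_prod_null hS]
    exact Filter.Eventually.of_forall fun g => hν ((measure_preimage_smul m g⁻¹ A).trans h0)
  exact Measure.measure_ae_null_of_prod_null (μ := ν) (ν := θ)
    (s := Prod.swap ⁻¹' {p : G × X | p.1⁻¹ • p.2 ∈ A}) (by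
      rw [← Measure.map_apply measurable_swap hS, Measure.prod_swap, h])

/-- Suppose that `γ (r x)` lies on the orbit of `x` for `ν`-almost every `x`. If `ν` is absolutely
continuous, then so is the measure obtained by spreading the law of `r` under `ν` along the orbits
through `γ`. -/
theorem map_inv_smul_absolutelyContinuous (θ : Measure G) [SFinite θ] [θ.IsMulLeftInvariant]
    (m ν : Measure X) [SMulInvariantMeasure G X m] [IsFiniteMeasure ν] (hν : ν ≪ m)
    {Z : Type*} [TopologicalSpace Z] [SecondCountableTopology Z] [MeasurableSpace Z] [BorelSpace Z]
    {r : X → Z} (hr : Measurable r) {γ : Z → X} (hγ : Continuous γ)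
    (hrγ : ∀ᵐ x ∂ν, ∃ g : G, g • x = γ (r x)) :
    (θ.prod (ν.map r)).map (fun p => p.1⁻¹ • γ p.2) ≪ m := by
  have hΦ : Measurable fun p : G × Z => p.1⁻¹ • γ p.2 :=
    (continuous_fst.inv.smul (hγ.comp continuous_snd)).measurable
  refine Measure.AbsolutelyContinuous.mk fun A hA h0 => ?_
  rw [Measure.map_apply hΦ hA, ← Measure.prod_swap, Measure.map_apply measurable_swap (hΦ hA),
    Measure.measure_prod_null (measurable_swap (hΦ hA))]
  have hmeas : MeasurableSet {z : Z | θ {g | g⁻¹ • γ z ∈ A} = 0} :=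
    (measurable_measure_prodMk_left (ν := θ) (measurable_swap (hΦ hA))) (measurableSet_singleton 0)
  refine (ae_map_iff hr.aemeasurable hmeas).2 ?_
  filter_upwards [ae_measure_inv_smul_mem_eq_zero θ m ν hν hA h0, hrγ] with x hx ⟨g, hg⟩
  rw [← hg, measure_inv_smul_mem_smul]
  exact hx

end Averaging

/-! ### Dynamical transports and 1-Lipschitz projections -/

namespace Geo

variable {X : Type*} [MetricSpace X]

theorem continuous_eval (t : I) : Continuous fun γ : Geo X => γ.eval t :=
  (continuous_eval_const (F := C(I, X)) t).comp continuous_induced_dom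

theorem measurable_eval [MeasurableSpace X] [BorelSpace X] (t : I) :
    Measurable fun γ : Geo X => γ.eval t :=
  (continuous_eval t).measurable

end Geo

/-- If a 1-Lipschitz map `r : X → Z` sends the end marginals of `η` to `α` and `β`, and `η` costs no
more than an optimal coupling of `α` and `β`, then `η` is a dynamical optimal transport. -/
theorem isOptGeo_of_lipschitz {X Z : Type*} [MetricSpace X] [SecondCountableTopology X]
    [MeasurableSpace X] [BorelSpace X] [MetricSpace Z] [SecondCountableTopology Z]
    [MeasurableSpace Z] [BorelSpace Z]
    {r : X → Z} (hr : LipschitzWith 1 r) (η : Measure (Geo X)) [IsProbabilityMeasure η]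
    {α β : Measure Z} {ρ : Measure (Z × Z)} (hρ : IsOptimalCoupling ρ α β)
    (hα : (η.map fun γ => γ.eval 0).map r = α) (hβ : (η.map fun γ => γ.eval 1).map r = β)
    (hcost : ∫⁻ γ, edist (γ.eval 0) (γ.eval 1) ^ 2 ∂η ≤ ∫⁻ p, edist p.1 p.2 ^ 2 ∂ρ) :
    IsOptGeo η (η.map fun γ => γ.eval 0) (η.map fun γ => γ.eval 1) := by
  have hm0 := Geo.measurable_eval (X := X) 0
  have hm1 := Geo.measurable_eval (X := X) 1
  have hrm : Measurable r := hr.continuous.measurable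
  have hcX : Measurable fun p : X × X => edist p.1 p.2 ^ 2 :=
    (continuous_fst.edist continuous_snd).measurable.pow_const 2
  have hcZ : Measurable fun p : Z × Z => edist p.1 p.2 ^ 2 :=
    (continuous_fst.edist continuous_snd).measurable.pow_const 2
  refine ⟨inferInstance, ⟨?_, ?_⟩, fun ρ' hρ' => ?_⟩
  · rw [Measure.map_map measurable_fst (hm0.prodMk hm1)]; rfl
  · rw [Measure.map_map measurable_snd (hm0.prodMk hm1)]; rfl
  · have hrr : Measurable fun p : X × X => (r p.1, r p.2) :=
      (hrm.comp measurable_fst).prodMk (hrm.comp measurable_snd)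
    have h1 : IsCoupling (ρ'.map fun p => (r p.1, r p.2)) α β := by
      constructor
      · rw [Measure.map_map measurable_fst hrr, ← hα, ← hρ'.1, Measure.map_map hrm measurable_fst]
        rfl
      · rw [Measure.map_map measurable_snd hrr, ← hβ, ← hρ'.2, Measure.map_map hrm measurable_snd]
        rfl
    calc ∫⁻ p, edist p.1 p.2 ^ 2 ∂(η.map fun γ => (γ.eval 0, γ.eval 1))
        = ∫⁻ γ, edist (γ.eval 0) (γ.eval 1) ^ 2 ∂η := lintegral_map hcX (hm0.prodMk hm1)
      _ ≤ ∫⁻ p, edist p.1 p.2 ^ 2 ∂ρ := hcost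
      _ ≤ ∫⁻ p, edist p.1 p.2 ^ 2 ∂(ρ'.map fun p => (r p.1, r p.2)) := hρ.2 _ h1
      _ = ∫⁻ p, edist (r p.1) (r p.2) ^ 2 ∂ρ' := lintegral_map hcZ hrr
      _ ≤ ∫⁻ p, edist p.1 p.2 ^ 2 ∂ρ' := by
          refine lintegral_mono fun p => ?_
          gcongr
          simpa using hr p.1 p.2

theorem isP2_of_ae_mem_ball {X : Type*} [MetricSpace X] [MeasurableSpace X] (μ : Measure X)
    [IsProbabilityMeasure μ] (x₀ : X) (R : ℝ) (h : ∀ᵐ x ∂μ, x ∈ Metric.ball x₀ R) : IsP2 μ := by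
  refine ⟨inferInstance, x₀, ?_⟩
  calc ∫⁻ x, edist x x₀ ^ 2 ∂μ ≤ ∫⁻ _, ENNReal.ofReal R ^ 2 ∂μ := by
        refine lintegral_mono_ae ?_
        filter_upwards [h] with x hx
        gcongr
        rw [edist_dist]
        exact ENNReal.ofReal_le_ofReal hx.le
    _ < ∞ := by simp

/-! ### Orbit projections and horizontal geodesics -/

/-- `q` is an isometric model of the orbit projection: its fibres are the orbits, and the distance
of `q x` from a point `b` is the distance, which is attained, of `x` from the orbit over `b`. -/
structure IsOrbitSubmetry (G : Type*) {X Y : Type*} [Group G] [MetricSpace X] [MulAction G X]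
    [MetricSpace Y] (q : X → Y) : Prop where
  eq_iff : ∀ x y, q x = q y ↔ ∃ g : G, g • x = y
  dist_le : ∀ x y, dist (q x) (q y) ≤ dist x y
  lift : ∀ (x : X) (b : Y), ∃ y, q y = b ∧ dist x y = dist (q x) b

/-- `c` is a unit speed minimizing geodesic of `Y` on `[a,b]`, the only one with its end points, and
it maps open subintervals to open sets. -/
structure IsSegmentChart {Y : Type*} [MetricSpace Y] (c : ℝ → Y) (a b : ℝ) : Prop where
  dist_eq : ∀ s ∈ Icc a b, ∀ t ∈ Icc a b, dist (c s) (c t) = |s - t|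
  isOpen_image : ∀ s t, a ≤ s → t ≤ b → IsOpen (c '' Ioo s t)
  eq_of_dist : ∀ s t u p, a ≤ s → s ≤ t → t ≤ u → u ≤ b → dist (c s) p = t - s →
    dist p (c u) = u - t → p = c t

namespace IsOrbitSubmetry

variable {G X Y : Type*} [Group G] [MetricSpace X] [MulAction G X] [MetricSpace Y] {q : X → Y}

theorem lipschitz (hq : IsOrbitSubmetry G q) : LipschitzWith 1 q :=
  LipschitzWith.of_dist_le_mul fun x y => by simpa using hq.dist_le x y

theorem continuous (hq : IsOrbitSubmetry G q) : Continuous q := hq.lipschitz.continuous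

theorem map_smul (hq : IsOrbitSubmetry G q) (g : G) (x : X) : q (g • x) = q x :=
  ((hq.eq_iff x (g • x)).2 ⟨g, rfl⟩).symm

end IsOrbitSubmetry

/-- The point `(1-u)s + ut` of an interval. -/
def segmentPoint {a b : ℝ} (p : Icc a b × Icc a b) (u : I) : Icc a b :=
  ⟨(1 - u) * p.1 + u * p.2, by
    have h := (convex_Icc a b) p.1.2 p.2.2 (sub_nonneg.2 u.2.2) u.2.1 (by ring)
    simpa using h⟩

theorem continuous_segmentPoint {a b : ℝ} :
    Continuous fun p : (Icc a b × Icc a b) × I => segmentPoint p.1 p.2 := by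
  unfold segmentPoint
  fun_prop

theorem dist_segmentPoint {a b : ℝ} (p : Icc a b × Icc a b) (u v : I) :
    dist (segmentPoint p u) (segmentPoint p v) = |(u : ℝ) - v| * dist p.1 p.2 := by
  simp only [segmentPoint, Subtype.dist_eq, Real.dist_eq]
  rw [← abs_mul, ← abs_neg]
  congr 1
  ring

@[simp] theorem segmentPoint_zero {a b : ℝ} (p : Icc a b × Icc a b) : segmentPoint p 0 = p.1 := by
  ext; simp [segmentPoint]

@[simp] theorem segmentPoint_one {a b : ℝ} (p : Icc a b × Icc a b) : segmentPoint p 1 = p.2 := by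
  ext; simp [segmentPoint]

section

variable {G X : Type*} [Group G] [MetricSpace X] [MulAction G X] [IsIsometricSMul G X] {a b : ℝ}

/-- For `p = (g,(s,t))`, the piece of the geodesic `g⁻¹ • γ` from time `s` to time `t`. -/
def translatedPiece {γ : Icc a b → X} (hγ : Isometry γ) (p : G × (Icc a b × Icc a b)) : Geo X :=
  ⟨⟨fun u => p.1⁻¹ • γ (segmentPoint p.2 u), (hγ.continuous.comp
      (continuous_segmentPoint.comp (Continuous.prodMk_right p.2))).const_smul _⟩, fun u v => by
    change dist (p.1⁻¹ • γ (segmentPoint p.2 u)) (p.1⁻¹ • γ (segmentPoint p.2 v)) =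
      _ * dist (p.1⁻¹ • γ (segmentPoint p.2 0)) (p.1⁻¹ • γ (segmentPoint p.2 1))
    simp only [dist_smul, hγ.dist_eq, dist_segmentPoint]
    simp⟩

@[simp] theorem eval_translatedPiece {γ : Icc a b → X} (hγ : Isometry γ)
    (p : G × (Icc a b × Icc a b)) (u : I) :
    (translatedPiece hγ p).eval u = p.1⁻¹ • γ (segmentPoint p.2 u) := rfl

theorem continuous_translatedPiece [TopologicalSpace G] [ContinuousInv G] [ContinuousSMul G X]
    {γ : Icc a b → X} (hγ : Isometry γ) :
    Continuous (translatedPiece (G := G) hγ) := by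
  refine continuous_induced_rng.2 (ContinuousMap.continuous_of_continuous_uncurry _ ?_)
  exact (continuous_fst.fst.inv).smul (hγ.continuous.comp (continuous_segmentPoint.comp
    (continuous_fst.snd.prodMk continuous_snd)))

end

/-! ### Horizontal geodesics do not branch -/

section

variable {G X Y : Type*} [Group G] [TopologicalSpace G] [IsTopologicalGroup G]
  [MeasurableSpace G] [BorelSpace G]
  [MetricSpace X] [MulAction G X] [ContinuousSMul G X]

theorem measurable_translatedPiece [IsIsometricSMul G X] {a b : ℝ} {γ : Icc a b → X}
    (hγ : Isometry γ) :
    Measurable (translatedPiece (G := G) hγ) :=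
  (continuous_translatedPiece hγ).measurable

variable [MeasurableSpace X] [BorelSpace X]

/-- Spreading a law along the orbits through a section of the invariant map `r` does not change the
law of `r`. -/
theorem map_map_inv_smul (θ : Measure G) [IsProbabilityMeasure θ] {Z : Type*} [TopologicalSpace Z]
    [SecondCountableTopology Z] [MeasurableSpace Z] [BorelSpace Z] {γ : Z → X}
    {r : X → Z} (hr : Measurable r)
    (hrγ : ∀ (g : G) t, r (g • γ t) = t) (α : Measure Z) [SFinite α] (hγ : Continuous γ) :
    ((θ.prod α).map (fun p => p.1⁻¹ • γ p.2)).map r = α := by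
  have h1 : Measurable fun p : G × Z => p.1⁻¹ • γ p.2 :=
    (continuous_fst.inv.smul (hγ.comp continuous_snd)).measurable
  rw [Measure.map_map hr h1]
  simp only [Function.comp_def, hrγ]
  change (θ.prod α).map Prod.snd = α
  simp

section Transport

variable [IsIsometricSMul G X]
variable {a b : ℝ} {γ : Icc a b → X} (hγ : Isometry γ) (θ : Measure G) [IsProbabilityMeasure θ]
  (ρ : Measure (Icc a b × Icc a b)) [IsProbabilityMeasure ρ]

theorem map_translatedPiece_eval_zero :
    ((θ.prod ρ).map (translatedPiece hγ)).map (fun δ => δ.eval 0) =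
      (θ.prod (ρ.map Prod.fst)).map (fun p => p.1⁻¹ • γ p.2) := by
  have h1 : Measurable fun p : G × Icc a b => p.1⁻¹ • γ p.2 :=
    (continuous_fst.inv.smul (hγ.continuous.comp continuous_snd)).measurable
  have h2 : θ.prod (ρ.map Prod.fst) =
      (θ.prod ρ).map (Prod.map id (Prod.fst : Icc a b × Icc a b → Icc a b)) := by
    rw [← Measure.map_prod_map _ _ measurable_id measurable_fst, Measure.map_id]
  rw [h2, Measure.map_map h1 (measurable_id.prodMap measurable_fst),
    Measure.map_map (Geo.measurable_eval 0) (measurable_translatedPiece hγ)]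
  congr 1
  ext p
  simp

theorem map_translatedPiece_eval_one :
    ((θ.prod ρ).map (translatedPiece hγ)).map (fun δ => δ.eval 1) =
      (θ.prod (ρ.map Prod.snd)).map (fun p => p.1⁻¹ • γ p.2) := by
  have h1 : Measurable fun p : G × Icc a b => p.1⁻¹ • γ p.2 :=
    (continuous_fst.inv.smul (hγ.continuous.comp continuous_snd)).measurable
  have h2 : θ.prod (ρ.map Prod.snd) =
      (θ.prod ρ).map (Prod.map id (Prod.snd : Icc a b × Icc a b → Icc a b)) := by
    rw [← Measure.map_prod_map _ _ measurable_id measurable_snd, Measure.map_id]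
  rw [h2, Measure.map_map h1 (measurable_id.prodMap measurable_snd),
    Measure.map_map (Geo.measurable_eval 1) (measurable_translatedPiece hγ)]
  congr 1
  ext p
  simp

theorem lintegral_edist_translatedPiece [SecondCountableTopology X] :
    ∫⁻ δ, edist (δ.eval 0) (δ.eval 1) ^ 2 ∂((θ.prod ρ).map (translatedPiece hγ)) =
      ∫⁻ p, edist p.1 p.2 ^ 2 ∂ρ := by
  have h0 := Geo.measurable_eval (X := X) 0
  have h1 := Geo.measurable_eval (X := X) 1
  have h : Measurable fun p : Icc a b × Icc a b => edist p.1 p.2 ^ 2 :=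
    (continuous_fst.edist continuous_snd).measurable.pow_const 2
  rw [lintegral_map ((h0.edist h1).pow_const 2) (measurable_translatedPiece hγ)]
  simp only [eval_translatedPiece, segmentPoint_zero, segmentPoint_one, edist_smul_left,
    hγ.edist_eq]
  have hsnd : (θ.prod ρ).map Prod.snd = ρ := by simp
  conv_rhs => rw [← hsnd, lintegral_map h measurable_snd]

end Transport

end

/-- The equal mixture of two measures. -/
noncomputable def halfMix {Ω : Type*} [MeasurableSpace Ω] (η η' : Measure Ω) : Measure Ω :=
  (2⁻¹ : ℝ≥0∞) • η + (2⁻¹ : ℝ≥0∞) • η'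

section halfMix

variable {Ω Ω' : Type*} [MeasurableSpace Ω] [MeasurableSpace Ω'] (η η' : Measure Ω)

instance [IsProbabilityMeasure η] [IsProbabilityMeasure η'] :
    IsProbabilityMeasure (halfMix η η') :=
  ⟨by simp [halfMix, ENNReal.inv_two_add_inv_two]⟩

theorem halfMix_self : halfMix η η = η := by
  rw [halfMix, ← add_smul, ENNReal.inv_two_add_inv_two, one_smul]

theorem map_halfMix {f : Ω → Ω'} (hf : Measurable f) :
    (halfMix η η').map f = halfMix (η.map f) (η'.map f) := by
  simp [halfMix, Measure.map_add _ _ hf]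

theorem lintegral_halfMix (f : Ω → ℝ≥0∞) {c : ℝ≥0∞} (h : ∫⁻ x, f x ∂η = c)
    (h' : ∫⁻ x, f x ∂η' = c) : ∫⁻ x, f x ∂(halfMix η η') = c := by
  simp only [halfMix, lintegral_add_measure, lintegral_smul_measure, h, h', smul_eq_mul]
  rw [← add_mul, ENNReal.inv_two_add_inv_two, one_mul]

theorem ae_halfMix {p : Ω → Prop} : (∀ᵐ x ∂(halfMix η η'), p x) ↔
    (∀ᵐ x ∂η, p x) ∧ ∀ᵐ x ∂η', p x := by
  simp [halfMix, ae_add_measure_iff]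

theorem halfMix_absolutelyContinuous {η η' ν : Measure Ω} (h : η ≪ ν) (h' : η' ≪ ν) :
    halfMix η η' ≪ ν :=
  Measure.AbsolutelyContinuous.add_left (h.smul_left _) (h'.smul_left _)

end halfMix

/-- The parameter in `[a,b]` read off from the distance to `c a`; it inverts `c` on `[a,b]`. -/
noncomputable def segmentParam {X Y : Type*} [MetricSpace Y] {a b : ℝ} (q : X → Y)
    (c : ℝ → Y) (hab : a ≤ b) (x : X) : Icc a b :=
  projIcc a b hab (a + dist (q x) (c a))

theorem IsSegmentChart.segmentParam_eq {X Y : Type*} [MetricSpace Y] {q : X → Y} {c : ℝ → Y}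
    {a b : ℝ} (hc : IsSegmentChart c a b) (hab : a ≤ b) (t : Icc a b)
    {x : X} (hx : q x = c t) : segmentParam q c hab x = t := by
  have h : a + dist (q x) (c a) = t := by
    rw [hx, hc.dist_eq _ t.2 _ (left_mem_Icc.2 hab), abs_of_nonneg (sub_nonneg.2 t.2.1)]
    ring
  rw [segmentParam, h, projIcc_val]

section

variable {G X Y : Type*} [Group G] [MetricSpace X] [MulAction G X] [MetricSpace Y]
  {q : X → Y} {c : ℝ → Y} {a b : ℝ}

theorem lipschitz_segmentParam (hq : IsOrbitSubmetry G q) (hab : a ≤ b) :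
    LipschitzWith 1 (segmentParam q c hab) := by
  refine LipschitzWith.of_dist_le_mul fun x y => ?_
  refine ((LipschitzWith.projIcc hab).dist_le_mul _ _).trans ?_
  simp only [NNReal.coe_one, one_mul, Real.dist_eq, add_sub_add_left_eq_sub]
  exact (abs_dist_sub_le _ _ _).trans (hq.dist_le x y)

variable [TopologicalSpace G] [IsTopologicalGroup G] [CompactSpace G]
  [SecondCountableTopology X] [MeasurableSpace X] [BorelSpace X]
  [ContinuousSMul G X] [IsIsometricSMul G X]

open ProbabilityTheory in
/-- Two horizontal geodesics over a segment that agree up to an interior time `s₀` agree before `b`.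
Otherwise the plan that, from a Haar random translate, follows either of them with probability one
half would be a branching dynamical optimal transport. -/
theorem IsEssentiallyNonbranching.horizontal_eq (m : Measure X) [m.IsOpenPosMeasure]
    (hm : ∀ (x : X) (r : ℝ), m (Metric.ball x r) < ∞) (hnb : IsEssentiallyNonbranching m)
    [SMulInvariantMeasure G X m] (hq : IsOrbitSubmetry G q) (hc : IsSegmentChart c a b) {s₀ : ℝ}
    (ha : a < s₀) (hb : s₀ < b) {γ₁ γ₂ : Icc a b → X} (hγ₁ : Isometry γ₁) (hγ₂ : Isometry γ₂)
    (hqγ₁ : ∀ t, q (γ₁ t) = c t) (hqγ₂ : ∀ t, q (γ₂ t) = c t)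
    (heq : ∀ t : Icc a b, (t : ℝ) ≤ s₀ → γ₁ t = γ₂ t) (t : Icc a b) (ht : (t : ℝ) < b) :
    γ₁ t = γ₂ t := by
  have hab : a ≤ b := (ha.trans hb).le
  rcases le_or_gt (t : ℝ) s₀ with hts | hts
  · exact heq t hts
  let _ : MeasurableSpace G := borel G
  have _ : BorelSpace G := ⟨rfl⟩
  let θ : Measure G := Measure.haarMeasure ⊤
  have hθ : IsProbabilityMeasure θ := ⟨Measure.haarMeasure_self⟩
  let r : X → Icc a b := segmentParam q c hab
  have hrL : LipschitzWith 1 r := lipschitz_segmentParam hq hab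
  have hrm : Measurable r := hrL.continuous.measurable
  have hr : ∀ (t : Icc a b) {x : X}, q x = c t → r x = t := hc.segmentParam_eq hab
  let x₀ := γ₁ t
  -- the part of `X` over the segment is compact, hence bounded
  obtain ⟨R, hR⟩ : ∃ R, q ⁻¹' (c '' Icc a b) ⊆ Metric.ball x₀ R := by
    have hK : IsCompact ((fun p : G × Icc a b => p.1 • γ₁ p.2) '' univ) :=
      isCompact_univ.image (continuous_fst.smul (hγ₁.continuous.comp continuous_snd))
    obtain ⟨R, hR⟩ := hK.isBounded.subset_ball x₀
    refine ⟨R, fun x hx => hR ?_⟩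
    obtain ⟨t, ht, htx⟩ := hx
    obtain ⟨g, hg⟩ := (hq.eq_iff (γ₁ ⟨t, ht⟩) x).1 ((hqγ₁ _).trans htx)
    exact ⟨(g, ⟨t, ht⟩), mem_univ _, hg⟩
  -- the law of the parameter over a subsegment
  have hcond : ∀ u v, a ≤ u → u < v → v ≤ b → IsProbabilityMeasure (m[|q ⁻¹' (c '' Ioo u v)]) := by
    intro u v hu huv hv
    have hmem : (u + v) / 2 ∈ Icc a b := ⟨by linarith, by linarith⟩
    refine cond_isProbabilityMeasure_of_finite ?_ ?_
    · refine (((hc.isOpen_image u v hu hv).preimage hq.continuous).measure_pos m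
        ⟨γ₁ ⟨_, hmem⟩, ?_⟩).ne'
      rw [mem_preimage, hqγ₁]
      exact mem_image_of_mem _ ⟨by dsimp only; linarith, by dsimp only; linarith⟩
    · refine (lt_of_le_of_lt (measure_mono (subset_trans ?_ hR)) (hm x₀ R)).ne
      exact preimage_mono (image_mono (Ioo_subset_Icc_self.trans (Icc_subset_Icc hu hv)))
  have hmemV : ∀ u v, a ≤ u → v ≤ b →
      ∀ᵐ x ∂m[|q ⁻¹' (c '' Ioo u v)], x ∈ q ⁻¹' (c '' Ioo u v) := fun u v hu hv =>
    ae_cond_mem ((hc.isOpen_image u v hu hv).preimage hq.continuous).measurableSet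
  have hac : ∀ {γ : Icc a b → X}, Isometry γ → (∀ t, q (γ t) = c t) → ∀ u v, a ≤ u → u < v →
      v ≤ b → (θ.prod ((m[|q ⁻¹' (c '' Ioo u v)]).map r)).map (fun p => p.1⁻¹ • γ p.2) ≪ m := by
    intro γ hγ hqγ u v hu huv hv
    have := hcond u v hu huv hv
    refine map_inv_smul_absolutelyContinuous θ m _ cond_absolutelyContinuous hrm hγ.continuous ?_
    filter_upwards [hmemV u v hu hv] with x hx
    obtain ⟨w, hw, hwx⟩ := hx
    have hw' : w ∈ Icc a b := ⟨hu.trans hw.1.le, hw.2.le.trans hv⟩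
    refine (hq.eq_iff _ _).1 ?_
    rw [hr ⟨w, hw'⟩ hwx.symm, hqγ, hwx]
  have := hcond a s₀ le_rfl ha hb.le
  have := hcond s₀ b ha.le hb le_rfl
  let α : Measure (Icc a b) := (m[|q ⁻¹' (c '' Ioo a s₀)]).map r
  let β : Measure (Icc a b) := (m[|q ⁻¹' (c '' Ioo s₀ b)]).map r
  have hα : IsProbabilityMeasure α := Measure.isProbabilityMeasure_map hrm.aemeasurable
  have hβ : IsProbabilityMeasure β := Measure.isProbabilityMeasure_map hrm.aemeasurable
  obtain ⟨ρ, hρp, hρ⟩ := exists_isOptimalCoupling α β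
  let η₁ : Measure (Geo X) := (θ.prod ρ).map (translatedPiece hγ₁)
  let η₂ : Measure (Geo X) := (θ.prod ρ).map (translatedPiece hγ₂)
  have hη₁ : IsProbabilityMeasure η₁ :=
    Measure.isProbabilityMeasure_map (measurable_translatedPiece hγ₁).aemeasurable
  have hη₂ : IsProbabilityMeasure η₂ :=
    Measure.isProbabilityMeasure_map (measurable_translatedPiece hγ₂).aemeasurable
  have he0 := Geo.measurable_eval (X := X) 0
  have he1 := Geo.measurable_eval (X := X) 1
  have hrγ : ∀ {γ : Icc a b → X}, (∀ t, q (γ t) = c t) → ∀ (g : G) t, r (g • γ t) = t :=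
    fun hqγ g t => hr t ((hq.map_smul g _).trans (hqγ t))
  have hm0 : ∀ {γ : Icc a b → X} (hγ : Isometry γ), (∀ t, q (γ t) = c t) →
      ((((θ.prod ρ).map (translatedPiece hγ)).map fun δ => δ.eval 0) ≪ m ∧
      (((θ.prod ρ).map (translatedPiece hγ)).map fun δ => δ.eval 0).map r = α) := by
    intro γ hγ hqγ
    rw [map_translatedPiece_eval_zero hγ θ ρ, hρ.1.1]
    exact ⟨hac hγ hqγ a s₀ le_rfl ha hb.le,
      map_map_inv_smul θ hrm (hrγ hqγ) α hγ.continuous⟩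
  have hm1 : ∀ {γ : Icc a b → X} (hγ : Isometry γ), (∀ t, q (γ t) = c t) →
      ((((θ.prod ρ).map (translatedPiece hγ)).map fun δ => δ.eval 1) ≪ m ∧
      (((θ.prod ρ).map (translatedPiece hγ)).map fun δ => δ.eval 1).map r = β) := by
    intro γ hγ hqγ
    rw [map_translatedPiece_eval_one hγ θ ρ, hρ.1.2]
    exact ⟨hac hγ hqγ s₀ b ha.le hb le_rfl,
      map_map_inv_smul θ hrm (hrγ hqγ) β hγ.continuous⟩
  have hball : ∀ u : I, ∀ᵐ x ∂((halfMix η₁ η₂).map fun δ => δ.eval u), x ∈ Metric.ball x₀ R := by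
    intro u
    have hball' : ∀ {γ : Icc a b → X} (hγ : Isometry γ), (∀ t, q (γ t) = c t) →
        ∀ᵐ δ ∂((θ.prod ρ).map (translatedPiece hγ)), δ.eval u ∈ Metric.ball x₀ R := by
      intro γ hγ hqγ
      refine (ae_map_iff (measurable_translatedPiece hγ).aemeasurable
        (Geo.measurable_eval u Metric.isOpen_ball.measurableSet)).2 (ae_of_all _ fun p => hR ?_)
      change p.1⁻¹ • γ (segmentPoint p.2 u) ∈ _
      rw [mem_preimage, hq.map_smul, hqγ]
      exact mem_image_of_mem _ (Subtype.coe_prop _)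
    refine (ae_map_iff (Geo.measurable_eval u).aemeasurable Metric.isOpen_ball.measurableSet).2 ?_
    exact (ae_halfMix _ _).2 ⟨hball' hγ₁ hqγ₁, hball' hγ₂ hqγ₂⟩
  have hopt : IsOptGeo (halfMix η₁ η₂) ((halfMix η₁ η₂).map fun δ => δ.eval 0)
      ((halfMix η₁ η₂).map fun δ => δ.eval 1) := by
    refine isOptGeo_of_lipschitz hrL _ hρ ?_ ?_ ?_
    · rw [map_halfMix _ _ he0, map_halfMix _ _ hrm, (hm0 hγ₁ hqγ₁).2, (hm0 hγ₂ hqγ₂).2,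
        halfMix_self]
    · rw [map_halfMix _ _ he1, map_halfMix _ _ hrm, (hm1 hγ₁ hqγ₁).2, (hm1 hγ₂ hqγ₂).2,
        halfMix_self]
    · exact (lintegral_halfMix _ _ _ (lintegral_edist_translatedPiece hγ₁ θ ρ)
        (lintegral_edist_translatedPiece hγ₂ θ ρ)).le
  have hp0 := Measure.isProbabilityMeasure_map (μ := halfMix η₁ η₂) he0.aemeasurable
  have hp1 := Measure.isProbabilityMeasure_map (μ := halfMix η₁ η₂) he1.aemeasurable
  obtain ⟨Γ, hΓ, hΓη⟩ := hnb _ _ (isP2_of_ae_mem_ball _ x₀ R (hball 0))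
    (isP2_of_ae_mem_ball _ x₀ R (hball 1))
    (by rw [map_halfMix _ _ he0]
        exact halfMix_absolutelyContinuous (hm0 hγ₁ hqγ₁).1 (hm0 hγ₂ hqγ₂).1)
    (by rw [map_halfMix _ _ he1]
        exact halfMix_absolutelyContinuous (hm1 hγ₁ hqγ₁).1 (hm1 hγ₂ hqγ₂).1) _ hopt
  obtain ⟨hΓ₁, hΓ₂⟩ := (ae_halfMix _ _).1 hΓη
  have hΓ₁' := ae_of_ae_map (measurable_translatedPiece hγ₁).aemeasurable hΓ₁
  have hΓ₂' := ae_of_ae_map (measurable_translatedPiece hγ₂).aemeasurable hΓ₂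
  -- almost surely the motion starts before `s₀` and ends after `s₀`
  have hsupp : ∀ u v, a ≤ u → v ≤ b → ∀ᵐ z : Icc a b ∂(m[|q ⁻¹' (c '' Ioo u v)]).map r,
      (z : ℝ) ∈ Ioo u v := by
    intro u v hu hv
    refine (ae_map_iff hrm.aemeasurable (measurable_subtype_coe measurableSet_Ioo)).2 ?_
    filter_upwards [hmemV u v hu hv] with x hx
    obtain ⟨w, hw, hwx⟩ := hx
    rw [hr ⟨w, hu.trans hw.1.le, hw.2.le.trans hv⟩ hwx.symm]
    exact hw
  have hstart : ∀ᵐ p ∂(θ.prod ρ), ((p.2.1 : Icc a b) : ℝ) ∈ Ioo a s₀ := by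
    have h1 : ∀ᵐ z : Icc a b ∂ρ.map Prod.fst, (z : ℝ) ∈ Ioo a s₀ := by
      rw [hρ.1.1]; exact hsupp a s₀ le_rfl hb.le
    have h2 : ∀ᵐ p ∂(θ.prod ρ).map Prod.snd, ((p.1 : Icc a b) : ℝ) ∈ Ioo a s₀ := by
      simpa using ae_of_ae_map measurable_fst.aemeasurable h1
    exact ae_of_ae_map measurable_snd.aemeasurable h2
  have hend : ∀ᵐ p ∂(θ.prod ρ), ((p.2.2 : Icc a b) : ℝ) ∈ Ioo s₀ b := by
    have h1 : ∀ᵐ z : Icc a b ∂ρ.map Prod.snd, (z : ℝ) ∈ Ioo s₀ b := by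
      rw [hρ.1.2]; exact hsupp s₀ b ha.le le_rfl
    have h2 : ∀ᵐ p ∂(θ.prod ρ).map Prod.snd, ((p.2 : Icc a b) : ℝ) ∈ Ioo s₀ b := by
      simpa using ae_of_ae_map measurable_snd.aemeasurable h1
    exact ae_of_ae_map measurable_snd.aemeasurable h2
  have hae : ∀ᵐ p ∂(θ.prod ρ), γ₁ p.2.2 = γ₂ p.2.2 := by
    filter_upwards [hΓ₁', hΓ₂', hstart, hend] with p h1 h2 hs he
    have hst : (0 : ℝ) < p.2.2 - p.2.1 := by linarith [hs.2, he.1]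
    -- the time at which the motion passes the branching level `s₀`
    let u : I := ⟨(s₀ - p.2.1) / (p.2.2 - p.2.1), div_nonneg (by linarith [hs.2]) hst.le,
      (div_le_one hst).2 (by linarith [he.1])⟩
    have h := hΓ _ h1 _ h2 u (Subtype.coe_lt_coe.1 (div_pos (by linarith [hs.2]) hst))
      (Subtype.coe_lt_coe.1 ((div_lt_one hst).2 (by linarith [he.1]))) (fun v hv => by
        rw [eval_translatedPiece, eval_translatedPiece, heq]
        have hv' : (v : ℝ) * (p.2.2 - p.2.1) ≤ s₀ - p.2.1 := (le_div_iff₀ hst).1 hv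
        simp only [segmentPoint]
        linarith)
    have h' := congrArg (fun δ : Geo X => δ.eval 1) h
    simpa using h'
  have hclosed : IsClosed {z : Icc a b | γ₁ z = γ₂ z} :=
    isClosed_eq hγ₁.continuous hγ₂.continuous
  have haeβ : ∀ᵐ z ∂β, γ₁ z = γ₂ z := by
    rw [← hρ.1.2]
    refine (ae_map_iff measurable_snd.aemeasurable hclosed.measurableSet).2 ?_
    have h2 : (θ.prod ρ).map Prod.snd = ρ := by simp
    rw [← h2]
    exact (ae_map_iff measurable_snd.aemeasurable
      (measurable_snd hclosed.measurableSet)).2 hae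
  have haeX := ae_of_ae_map hrm.aemeasurable haeβ
  -- a violation would be an open condition on a set of positive measure
  by_contra hne
  have hO := (hc.isOpen_image s₀ b ha.le le_rfl).preimage hq.continuous
  have hU : IsOpen (q ⁻¹' (c '' Ioo s₀ b) ∩ {x | γ₁ (r x) ≠ γ₂ (r x)}) :=
    hO.inter (hclosed.isOpen_compl.preimage hrL.continuous)
  refine (hU.measure_pos m ⟨γ₁ t, ?_, ?_⟩).ne' ?_
  · rw [mem_preimage, hqγ₁]
    exact mem_image_of_mem _ ⟨hts, ht⟩
  · change γ₁ (r (γ₁ t)) ≠ γ₂ (r (γ₁ t))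
    rwa [hr t (hqγ₁ t)]
  · rw [ae_iff, cond_apply hO.measurableSet] at haeX
    rcases mul_eq_zero.1 haeX with h | h
    · exact absurd (ENNReal.inv_eq_zero.1 h) (ne_top_of_le_ne_top (hm x₀ R).ne (measure_mono
        ((preimage_mono (image_mono (Ioo_subset_Icc_self.trans
          (Icc_subset_Icc ha.le le_rfl)))).trans hR)))
    · exact h

end

/-! ### Unique horizontal lifts -/

namespace IsSegmentChart

variable {Y : Type*} [MetricSpace Y] {c : ℝ → Y} {a b : ℝ}

theorem mono (hc : IsSegmentChart c a b) {a' b' : ℝ} (ha : a ≤ a') (hb : b' ≤ b) :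
    IsSegmentChart c a' b' where
  dist_eq s hs t ht := hc.dist_eq s (Icc_subset_Icc ha hb hs) t (Icc_subset_Icc ha hb ht)
  isOpen_image s t hs ht := hc.isOpen_image s t (ha.trans hs) (ht.trans hb)
  eq_of_dist s t u p hs hst htu hu := hc.eq_of_dist s t u p (ha.trans hs) hst htu (hu.trans hb)

theorem comp_neg (hc : IsSegmentChart c a b) : IsSegmentChart (fun t => c (-t)) (-b) (-a) where
  dist_eq s hs t ht := by
    rw [hc.dist_eq (-s) ⟨by linarith [hs.2], by linarith [hs.1]⟩ (-t)
      ⟨by linarith [ht.2], by linarith [ht.1]⟩, abs_sub_comm]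
    congr 1
    ring
  isOpen_image s t hs ht := by
    have h := hc.isOpen_image (-t) (-s) (by linarith) (by linarith)
    rwa [← image_neg_Ioo, image_image] at h
  eq_of_dist s t u p hs hst htu hu h1 h2 :=
    hc.eq_of_dist (-u) (-t) (-s) p (by linarith) (by linarith) (by linarith) (by linarith)
      (by rw [dist_comm, h2]; ring) (by rw [dist_comm, h1]; ring)

end IsSegmentChart

section

variable {G X Y : Type*} [Group G] [MetricSpace X] [MulAction G X] [MetricSpace Y]
  {q : X → Y} {c : ℝ → Y} {a b : ℝ}

/-- A geodesic of `X` whose length is the distance between the orbits of its end points lies over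
the geodesic `c`, as that is the only one with its end points. -/
theorem IsGeodesicSpace.exists_horizontal (hgeo : IsGeodesicSpace X) (hq : IsOrbitSubmetry G q)
    (hc : IsSegmentChart c a b) (hab : a < b) {x y : X} (hx : q x = c a) (hy : q y = c b)
    (hxy : dist x y = b - a) :
    ∃ δ : ℝ → X, δ a = x ∧ δ b = y ∧ (∀ t ∈ Icc a b, q (δ t) = c t) ∧
      ∀ s ∈ Icc a b, ∀ t ∈ Icc a b, dist (δ s) (δ t) = |s - t| := by
  obtain ⟨e, rfl, rfl⟩ := hgeo x y
  have hba : 0 < b - a := sub_pos.2 hab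
  let δ : ℝ → X := fun t => e.eval (projIcc 0 1 zero_le_one ((t - a) / (b - a)))
  have hδa : δ a = e.eval 0 := by
    simp only [δ, sub_self, zero_div, projIcc_left]; rfl
  have hδb : δ b = e.eval 1 := by
    simp only [δ, div_self hba.ne', projIcc_right]; rfl
  have hδ : ∀ s ∈ Icc a b, ∀ t ∈ Icc a b, dist (δ s) (δ t) = |s - t| := by
    intro s hs t ht
    have hmem : ∀ t ∈ Icc a b, (t - a) / (b - a) ∈ Icc (0 : ℝ) 1 := fun t ht =>
      ⟨div_nonneg (by linarith [ht.1]) hba.le, (div_le_one hba).2 (by linarith [ht.2])⟩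
    refine (e.2 _ _).trans ?_
    change _ * dist (e.eval 0) (e.eval 1) = _
    rw [hxy, projIcc_of_mem _ (hmem s hs), projIcc_of_mem _ (hmem t ht), ← sub_div, abs_div,
      abs_of_pos hba, div_mul_cancel₀ _ hba.ne']
    congr 1
    ring
  refine ⟨δ, hδa, hδb, fun t ht => ?_, hδ⟩
  have ha' := left_mem_Icc.2 hab.le
  have hb' := right_mem_Icc.2 hab.le
  have h1 : dist (c a) (q (δ t)) ≤ t - a := by
    have h := (hq.dist_le (δ a) (δ t)).trans_eq (hδ a ha' t ht)
    rwa [hδa, hx, abs_sub_comm, abs_of_nonneg (by linarith [ht.1])] at h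
  have h2 : dist (q (δ t)) (c b) ≤ b - t := by
    have h := (hq.dist_le (δ t) (δ b)).trans_eq (hδ t ht b hb')
    rwa [hδb, hy, abs_sub_comm, abs_of_nonneg (by linarith [ht.2])] at h
  have h3 := hc.dist_eq a ha' b hb'
  rw [abs_sub_comm, abs_of_pos hba] at h3
  have h4 := dist_triangle (c a) (q (δ t)) (c b)
  exact hc.eq_of_dist a t b _ le_rfl ht.1 ht.2 le_rfl (by linarith) (by linarith)

variable [TopologicalSpace G] [IsTopologicalGroup G] [CompactSpace G]
  [SecondCountableTopology X] [MeasurableSpace X] [BorelSpace X]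
  [ContinuousSMul G X] [IsIsometricSMul G X]

/-- From a point over an interior time, the horizontal lift to the end of the segment is unique. -/
theorem IsEssentiallyNonbranching.lift_end_unique (m : Measure X) [m.IsOpenPosMeasure]
    (hm : ∀ (x : X) (r : ℝ), m (Metric.ball x r) < ∞) (hgeo : IsGeodesicSpace X)
    (hnb : IsEssentiallyNonbranching m)
    [SMulInvariantMeasure G X m] (hq : IsOrbitSubmetry G q) (hc : IsSegmentChart c a b) {s₀ : ℝ}
    (ha : a < s₀) (hb : s₀ < b) {x y₁ y₂ : X} (hx : q x = c s₀) (hy₁ : q y₁ = c b)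
    (hy₂ : q y₂ = c b) (h₁ : dist x y₁ = b - s₀) (h₂ : dist x y₂ = b - s₀) : y₁ = y₂ := by
  have hab := ha.trans hb
  obtain ⟨z, hz, hzx⟩ := hq.lift x (c a)
  rw [hx, hc.dist_eq _ ⟨ha.le, hb.le⟩ _ ⟨le_rfl, hab.le⟩, abs_of_pos (sub_pos.2 ha)] at hzx
  obtain ⟨δ₀, -, hδ₀x, hqδ₀, hδ₀⟩ := hgeo.exists_horizontal hq (hc.mono le_rfl hb.le) ha hz hx
    ((dist_comm _ _).trans hzx)
  -- continue `δ₀` by a geodesic from `x` to `y`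
  have hcat : ∀ y, q y = c b → dist x y = b - s₀ → ∃ γ : Icc a b → X, Isometry γ ∧
      (∀ t, q (γ t) = c t) ∧ (∀ t : Icc a b, (t : ℝ) ≤ s₀ → γ t = δ₀ t) ∧
      γ ⟨b, right_mem_Icc.2 hab.le⟩ = y := by
    intro y hy hxy
    obtain ⟨δ, hδx, hδy, hqδ, hδ⟩ := hgeo.exists_horizontal hq (hc.mono ha.le le_rfl) hb hx hy hxy
    let γ : Icc a b → X := fun t => if (t : ℝ) ≤ s₀ then δ₀ t else δ t
    have hqγ : ∀ t, q (γ t) = c t := by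
      intro t
      by_cases ht : (t : ℝ) ≤ s₀
      · simp only [γ, if_pos ht]
        exact hqδ₀ t ⟨t.2.1, ht⟩
      · simp only [γ, if_neg ht]
        exact hqδ t ⟨(not_le.1 ht).le, t.2.2⟩
    have hle : ∀ s t : Icc a b, (s : ℝ) ≤ t → dist (γ s) (γ t) ≤ t - s := by
      intro s t hst
      by_cases ht : (t : ℝ) ≤ s₀
      · simp only [γ, if_pos ht, if_pos (hst.trans ht)]
        rw [hδ₀ s ⟨s.2.1, hst.trans ht⟩ t ⟨t.2.1, ht⟩, abs_sub_comm,
          abs_of_nonneg (sub_nonneg.2 hst)]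
      · have ht' := (not_le.1 ht).le
        by_cases hs : (s : ℝ) ≤ s₀
        · simp only [γ, if_pos hs, if_neg ht]
          have e1 := hδ₀ s ⟨s.2.1, hs⟩ s₀ ⟨ha.le, le_rfl⟩
          have e2 := hδ s₀ ⟨le_rfl, hb.le⟩ t ⟨ht', t.2.2⟩
          rw [hδ₀x, abs_sub_comm, abs_of_nonneg (sub_nonneg.2 hs)] at e1
          rw [hδx, abs_sub_comm, abs_of_nonneg (sub_nonneg.2 ht')] at e2
          linarith [dist_triangle (δ₀ s) x (δ t)]
        · simp only [γ, if_neg ht, if_neg hs]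
          rw [hδ s ⟨(not_le.1 hs).le, s.2.2⟩ t ⟨ht', t.2.2⟩, abs_sub_comm,
            abs_of_nonneg (sub_nonneg.2 hst)]
    have hge : ∀ s t : Icc a b, |(s : ℝ) - t| ≤ dist (γ s) (γ t) := by
      intro s t
      rw [← hc.dist_eq s s.2 t t.2, ← hqγ, ← hqγ]
      exact hq.dist_le _ _
    refine ⟨γ, Isometry.of_dist_eq fun s t => le_antisymm ?_ (hge s t), hqγ,
      fun t ht => if_pos ht, ?_⟩
    · rcases le_total (s : ℝ) t with h | h
      · rw [dist_comm s t]
        exact (hle s t h).trans (le_abs_self _)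
      · rw [dist_comm (γ s)]
        exact (hle t s h).trans (le_abs_self _)
    · simp only [γ, if_neg (not_le.2 hb), hδy]
  obtain ⟨γ₁, hγ₁, hqγ₁, hδ₁, rfl⟩ := hcat y₁ hy₁ h₁
  obtain ⟨γ₂, hγ₂, hqγ₂, hδ₂, rfl⟩ := hcat y₂ hy₂ h₂
  have heq := hnb.horizontal_eq m hm hq hc ha hb hγ₁ hγ₂ hqγ₁ hqγ₂
    (fun t ht => (hδ₁ t ht).trans (hδ₂ t ht).symm)
  -- the two geodesics agree before time `b`, hence at time `b`
  refine eq_of_forall_dist_le fun ε hε => ?_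
  have h3 := le_max_left a (b - ε / 2)
  have h4 := le_max_right a (b - ε / 2)
  let t : Icc a b := ⟨max a (b - ε / 2), h3, max_le hab.le (by linarith)⟩
  have ht : (t : ℝ) < b := max_lt hab (by linarith)
  have hbt : dist (⟨b, right_mem_Icc.2 hab.le⟩ : Icc a b) t ≤ ε / 2 := by
    rw [Subtype.dist_eq, Real.dist_eq, abs_of_pos (sub_pos.2 ht)]
    linarith
  calc _ ≤ _ := dist_triangle _ (γ₁ t) _
    _ ≤ ε / 2 + ε / 2 := by
      refine add_le_add ?_ ?_
      · rwa [hγ₁.dist_eq]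
      · rw [heq t ht, hγ₂.dist_eq, dist_comm]
        exact hbt
    _ = ε := add_halves ε

/-- Points over `t` at the least possible distance from a given point over an interior time of an
interval of geodesic charts are unique. -/
theorem IsEssentiallyNonbranching.lift_unique (m : Measure X) [m.IsOpenPosMeasure]
    (hm : ∀ (x : X) (r : ℝ), m (Metric.ball x r) < ∞) (hgeo : IsGeodesicSpace X)
    (hnb : IsEssentiallyNonbranching m)
    [SMulInvariantMeasure G X m] (hq : IsOrbitSubmetry G q) {J : Set ℝ}
    (hJ : ∀ a ∈ J, ∀ b ∈ J, IsSegmentChart c a b) {s t : ℝ} (hs : (∃ a ∈ J, a < s) ∧ ∃ b ∈ J, s < b)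
    (ht : t ∈ J) {x y₁ y₂ : X} (hx : q x = c s) (hy₁ : q y₁ = c t)
    (hy₂ : q y₂ = c t) (h₁ : dist x y₁ = |s - t|) (h₂ : dist x y₂ = |s - t|) : y₁ = y₂ := by
  obtain ⟨⟨a, ha, has⟩, b, hb, hsb⟩ := hs
  rcases lt_trichotomy s t with hst | rfl | hst
  · rw [abs_sub_comm, abs_of_pos (sub_pos.2 hst)] at h₁ h₂
    exact hnb.lift_end_unique m hm hgeo hq (hJ a ha t ht) has hst hx hy₁ hy₂ h₁ h₂
  · simp only [sub_self, abs_zero, dist_eq_zero] at h₁ h₂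
    exact h₁.symm.trans h₂
  · rw [abs_of_pos (sub_pos.2 hst)] at h₁ h₂
    refine hnb.lift_end_unique m hm hgeo hq (hJ t ht b hb).comp_neg (neg_lt_neg hsb)
      (neg_lt_neg hst) (x := x) ?_ ?_ ?_ ?_ ?_
    · rw [neg_neg, hx]
    · rw [neg_neg, hy₁]
    · rw [neg_neg, hy₂]
    · rw [h₁]; ring
    · rw [h₂]; ring

/-- Through every point `x` over an interior time there is a horizontal geodesic over the whole
interval. As it is the only one, the isotropy group of `x` fixes it pointwise, and the isotropy
group is constant in the interior. -/
theorem IsEssentiallyNonbranching.exists_section (m : Measure X) [m.IsOpenPosMeasure]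
    (hm : ∀ (x : X) (r : ℝ), m (Metric.ball x r) < ∞) (hgeo : IsGeodesicSpace X)
    (hnb : IsEssentiallyNonbranching m)
    [SMulInvariantMeasure G X m] (hq : IsOrbitSubmetry G q) {J : Set ℝ}
    (hJ : ∀ a ∈ J, ∀ b ∈ J, IsSegmentChart c a b) {s₀ : ℝ} (hs₀ : s₀ ∈ J)
    (hs₀' : (∃ a ∈ J, a < s₀) ∧ ∃ b ∈ J, s₀ < b) {x : X} (hx : q x = c s₀) :
    ∃ γ : J → X, Isometry γ ∧ (∀ t, q (γ t) = c t) ∧ γ ⟨s₀, hs₀⟩ = x ∧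
      (∀ t : J, ((∃ a ∈ J, a < (t : ℝ)) ∧ ∃ b ∈ J, (t : ℝ) < b) →
        MulAction.stabilizer G (γ t) = MulAction.stabilizer G x) ∧
      ∀ t, MulAction.stabilizer G x ≤ MulAction.stabilizer G (γ t) := by
  have hdist : ∀ s ∈ J, ∀ t ∈ J, dist (c s) (c t) = |s - t| := by
    intro s hs t ht
    rcases le_total s t with h | h
    · exact (hJ s hs t ht).dist_eq s ⟨le_rfl, h⟩ t ⟨h, le_rfl⟩
    · exact (hJ t ht s hs).dist_eq s ⟨h, le_rfl⟩ t ⟨le_rfl, h⟩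
  have huniq : ∀ {s t : ℝ}, ((∃ a ∈ J, a < s) ∧ ∃ b ∈ J, s < b) → t ∈ J → ∀ {x y₁ y₂ : X},
      q x = c s → q y₁ = c t → q y₂ = c t → dist x y₁ = |s - t| → dist x y₂ = |s - t| → y₁ = y₂ :=
    fun hs ht _ _ _ => hnb.lift_unique m hm hgeo hq hJ hs ht
  have hex : ∀ t : J, ∃ y, q y = c t ∧ dist x y = |s₀ - t| := by
    intro t
    obtain ⟨y, hy, hxy⟩ := hq.lift x (c t)
    exact ⟨y, hy, by rw [hxy, hx, hdist s₀ hs₀ t t.2]⟩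
  choose γ hqγ hxγ using hex
  have hge : ∀ s t : J, |(s : ℝ) - t| ≤ dist (γ s) (γ t) := by
    intro s t
    rw [← hdist s s.2 t t.2, ← hqγ, ← hqγ]
    exact hq.dist_le _ _
  -- `γ` is additive along an interval that starts at `s₀`
  have hadd : ∀ s t : J, |s₀ - t| = |s₀ - s| + |(s : ℝ) - t| →
      dist (γ s) (γ t) ≤ |(s : ℝ) - t| := by
    intro s t hst
    obtain ⟨y, hy, hsy⟩ := hq.lift (γ s) (c t)
    rw [hqγ, hdist s s.2 t t.2] at hsy
    have hxy : dist x y = |s₀ - t| := by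
      refine le_antisymm ?_ ?_
      · rw [hst, ← hxγ s, ← hsy]
        exact dist_triangle _ _ _
      · rw [← hdist s₀ hs₀ t t.2, ← hx, ← hy]
        exact hq.dist_le _ _
    rw [huniq hs₀' t.2 hx (hqγ t) hy (hxγ t) hxy, hsy]
  have hle : ∀ s t : J, (s : ℝ) ≤ t → dist (γ s) (γ t) ≤ |(s : ℝ) - t| := by
    intro s t hst
    rcases le_total s₀ s with h | h
    · refine hadd s t ?_
      rw [abs_of_nonpos (by linarith), abs_of_nonpos (by linarith), abs_of_nonpos (by linarith)]
      ring
    · rcases le_total (t : ℝ) s₀ with h' | h'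
      · rw [dist_comm, abs_sub_comm]
        refine hadd t s ?_
        rw [abs_of_nonneg (by linarith), abs_of_nonneg (by linarith), abs_of_nonneg (by linarith)]
        ring
      · have h1 := dist_triangle_left (γ s) (γ t) x
        rw [hxγ, hxγ, abs_of_nonneg (by linarith), abs_of_nonpos (by linarith)] at h1
        rw [abs_of_nonpos (by linarith)]
        linarith
  have hstab : ∀ (t : J) (g : G), g • x = x → g • γ t = γ t := by
    intro t g hg
    refine huniq hs₀' t.2 hx ((hq.map_smul g _).trans (hqγ t)) (hqγ t) ?_ (hxγ t)
    calc dist x (g • γ t) = dist (g • x) (g • γ t) := by rw [hg]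
      _ = |s₀ - t| := (dist_smul _ _ _).trans (hxγ t)
  refine ⟨γ, Isometry.of_dist_eq fun s t => le_antisymm ?_ (hge s t), hqγ, ?_, ?_, ?_⟩
  · rcases le_total (s : ℝ) t with h | h
    · exact hle s t h
    · rw [dist_comm, dist_comm s]
      exact hle t s h
  · have h := hxγ ⟨s₀, hs₀⟩
    rw [sub_self, abs_zero, dist_eq_zero] at h
    exact h.symm
  · intro t ht
    ext g
    simp only [MulAction.mem_stabilizer_iff]
    constructor
    · intro hg
      refine huniq ht hs₀ (hqγ t) ((hq.map_smul g x).trans hx) hx ?_ ?_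
      · rw [← hg, dist_smul, dist_comm, hxγ, abs_sub_comm]
      · rw [dist_comm, hxγ, abs_sub_comm]
    · exact hstab t g
  · exact fun t g => hstab t g

end

/-! ### Cone bundles in a `G`-space -/

theorem isClosed_stabilizer (G : Type*) {X : Type*} [Group G] [TopologicalSpace G]
    [TopologicalSpace X] [T1Space X] [MulAction G X] [ContinuousSMul G X] (x : X) :
    IsClosed (MulAction.stabilizer G x : Set G) :=
  isClosed_singleton.preimage (continuous_id.smul continuous_const : Continuous fun g : G => g • x)

/-- The class of `K/H` in a point `[g,[kH,t]]` can be moved to the base point. -/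
theorem ConeBundle.exists_eq_mk {G T : Type*} [Group G] [Zero T] {K H : Subgroup G}
    (z : ConeBundle T K H) :
    ∃ (g : G) (t : T), z = ConeBundle.mk K H g ((1 : K) : K ⧸ H.subgroupOf K) t := by
  obtain ⟨g, w⟩ := z
  obtain ⟨y, t⟩ := w
  obtain ⟨k, rfl⟩ := QuotientGroup.mk_surjective y
  refine ⟨g * k, t, Quotient.sound ⟨k⁻¹, by simp, ?_⟩⟩
  change TopCone.mk _ t = TopCone.mk (k⁻¹ • _) t
  congr 1
  exact congrArg QuotientGroup.mk (by simp)

theorem ConeBundle.mk_mul {G T : Type*} [Group G] [Zero T] {K H : Subgroup G} (g : G) (k : K)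
    (y : K ⧸ H.subgroupOf K) (t : T) :
    ConeBundle.mk K H (g * k) y t = ConeBundle.mk K H g (k • y) t :=
  Quotient.sound ⟨k, by simp, rfl⟩

theorem ConeBundle.mk_zero {G T : Type*} [Group G] [Zero T] {K H : Subgroup G} (g : G)
    (y y' : K ⧸ H.subgroupOf K) : ConeBundle.mk K H g y (0 : T) = ConeBundle.mk K H g y' 0 := by
  have h : TopCone.mk y (0 : T) = TopCone.mk y' 0 := Quotient.sound (Or.inr ⟨rfl, rfl⟩)
  rw [ConeBundle.mk, h, ConeBundle.mk]

theorem ConeBundle.smul_mk {G T : Type*} [Group G] [Zero T] {K H : Subgroup G} (g g' : G)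
    (y : K ⧸ H.subgroupOf K) (t : T) :
    g • ConeBundle.mk K H g' y t = ConeBundle.mk K H (g * g') y t := rfl

section ConeMap

variable {G X T : Type*} [Group G] [MulAction G X] [Zero T] {K H : Subgroup G} {γ : T → X}

/-- The map `[kH,t] ↦ k • γ t` from the cone over `K/H`, where `γ` is a curve whose points are fixed
by `H` and whose initial point is fixed by `K`. -/
def coneFibreMap (hH : ∀ t, H ≤ MulAction.stabilizer G (γ t))
    (hK : K ≤ MulAction.stabilizer G (γ 0)) : TopCone T (K ⧸ H.subgroupOf K) → X :=
  Quotient.lift (fun p => Quotient.liftOn' p.1 (fun k : K => (k : G) • γ p.2) (by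
      intro k k' h
      rw [QuotientGroup.leftRel_apply, Subgroup.mem_subgroupOf] at h
      have h' : ((k⁻¹ * k' : K) : G) • γ p.2 = γ p.2 := hH p.2 h
      change (k : G) • γ p.2 = (k' : G) • γ p.2
      conv_lhs => rw [← h', smul_smul]
      simp)) (by
    rintro ⟨y, t⟩ ⟨y', t'⟩ (h | ⟨h, h'⟩)
    · rw [h]
    · obtain ⟨k, rfl⟩ := QuotientGroup.mk_surjective y
      obtain ⟨k', rfl⟩ := QuotientGroup.mk_surjective y'
      obtain rfl : t = 0 := h
      obtain rfl : t' = 0 := h'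
      exact (hK k.2 : (k : G) • γ 0 = γ 0).trans (hK k'.2 : (k' : G) • γ 0 = γ 0).symm)

/-- The equivariant map `[g,[kH,t]] ↦ g • k • γ t` from the cone bundle. -/
def coneBundleMap (hH : ∀ t, H ≤ MulAction.stabilizer G (γ t))
    (hK : K ≤ MulAction.stabilizer G (γ 0)) : ConeBundle T K H → X :=
  Quotient.lift (fun p => p.1 • coneFibreMap hH hK p.2) (by
    rintro ⟨g, z⟩ ⟨g', z'⟩ ⟨k, h, h'⟩
    obtain ⟨y, t⟩ := z
    obtain ⟨l, rfl⟩ := QuotientGroup.mk_surjective y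
    dsimp only at h h'
    subst h h'
    change g • (l : G) • γ t = (g * (k : G)⁻¹) • ((k * l : K) : G) • γ t
    simp [smul_smul, mul_assoc])

variable {hH : ∀ t, H ≤ MulAction.stabilizer G (γ t)} {hK : K ≤ MulAction.stabilizer G (γ 0)}

theorem coneBundleMap_mk (g : G) (k : K) (t : T) :
    coneBundleMap hH hK (ConeBundle.mk K H g (k : K ⧸ H.subgroupOf K) t) =
      (g * k) • γ t :=
  smul_smul _ _ _

theorem coneBundleMap_mk_one (g : G) (t : T) :
    coneBundleMap hH hK (ConeBundle.mk K H g ((1 : K) : K ⧸ H.subgroupOf K) t) = g • γ t := by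
  simp [coneBundleMap_mk]

theorem coneBundleMap_smul (g : G) (z : ConeBundle T K H) :
    coneBundleMap hH hK (g • z) = g • coneBundleMap hH hK z := by
  obtain ⟨g', t, rfl⟩ := z.exists_eq_mk
  rw [ConeBundle.smul_mk, coneBundleMap_mk_one, coneBundleMap_mk_one, mul_smul]

theorem coneBundleMap_injective (hH' : ∀ t ≠ 0, MulAction.stabilizer G (γ t) ≤ H)
    (hK' : MulAction.stabilizer G (γ 0) ≤ K)
    (horb : ∀ (g : G) s t, g • γ s = γ t → s = t) : Function.Injective (coneBundleMap hH hK) := by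
  intro z z' h
  obtain ⟨g, s, rfl⟩ := z.exists_eq_mk
  obtain ⟨g', t, rfl⟩ := z'.exists_eq_mk
  rw [coneBundleMap_mk_one, coneBundleMap_mk_one] at h
  have h' : (g'⁻¹ * g) • γ s = γ t := by rw [mul_smul, h, inv_smul_smul]
  obtain rfl := horb _ _ _ h'
  have hg : g = g' * (g'⁻¹ * g) := by group
  by_cases hs : s = 0
  · subst hs
    rw [hg, ConeBundle.mk_mul g' ⟨g'⁻¹ * g, hK' h'⟩]
    exact ConeBundle.mk_zero _ _ _
  · have hgH : g'⁻¹ * g ∈ H := hH' s hs h'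
    have hgK : g'⁻¹ * g ∈ K := hK' (by
      have := hH 0 hgH
      exact this)
    rw [hg, ConeBundle.mk_mul g' ⟨g'⁻¹ * g, hgK⟩]
    congr 1
    refine (QuotientGroup.eq (s := H.subgroupOf K)).2 ?_
    rw [Subgroup.mem_subgroupOf]
    simpa using H.inv_mem hgH

variable [TopologicalSpace G] [TopologicalSpace T]

theorem ConeBundle.continuous_mk_one :
    Continuous fun p : G × T => ConeBundle.mk K H p.1 ((1 : K) : K ⧸ H.subgroupOf K) p.2 := by
  have h1 : Continuous fun t : T => TopCone.mk ((1 : K) : K ⧸ H.subgroupOf K) t :=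
    continuous_quotient_mk'.comp (Continuous.prodMk_right _)
  exact continuous_quotient_mk'.comp (continuous_fst.prodMk (h1.comp continuous_snd))

variable [IsTopologicalGroup G] [TopologicalSpace X] [ContinuousSMul G X]

theorem continuous_coneBundleMap (hγ : Continuous γ) : Continuous (coneBundleMap hH hK) := by
  have h1 : Continuous (coneFibreMap hH hK) := by
    refine Continuous.quotient_lift ?_ _
    have hmk : IsOpenQuotientMap
        (Prod.map (QuotientGroup.mk : K → K ⧸ H.subgroupOf K) (id : T → T)) :=
      IsOpenQuotientMap.prodMap QuotientGroup.isOpenQuotientMap_mk IsOpenQuotientMap.id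
    refine hmk.continuous_comp_iff.1 ?_
    exact (continuous_subtype_val.comp continuous_fst).smul (hγ.comp continuous_snd)
  exact Continuous.quotient_lift (continuous_fst.smul (h1.comp continuous_snd)) _

/-- The cone bundle map is a closed embedding if `γ` meets each orbit at most once, the isotropy
groups along `γ` are exactly `K` and `H`, and `(g,t) ↦ g • γ t` is a closed map. -/
theorem isClosedEmbedding_coneBundleMap (hγ : Continuous γ)
    (hH' : ∀ t ≠ 0, MulAction.stabilizer G (γ t) ≤ H)
    (hK' : MulAction.stabilizer G (γ 0) ≤ K)
    (horb : ∀ (g : G) s t, g • γ s = γ t → s = t)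
    (hcl : IsClosedMap fun p : G × T => p.1 • γ p.2) :
    IsClosedEmbedding (coneBundleMap hH hK) := by
  refine IsClosedEmbedding.of_continuous_injective_isClosedMap (continuous_coneBundleMap hγ)
    (coneBundleMap_injective hH' hK' horb) fun C hC => ?_
  have h := hcl _ (hC.preimage (ConeBundle.continuous_mk_one (K := K) (H := H)))
  convert h using 1
  ext x
  constructor
  · rintro ⟨z, hz, rfl⟩
    obtain ⟨g, t, rfl⟩ := z.exists_eq_mk
    exact ⟨(g, t), hz, coneBundleMap_mk_one g t |>.symm⟩
  · rintro ⟨⟨g, t⟩, hz, rfl⟩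
    exact ⟨_, hz, coneBundleMap_mk_one g t⟩

end ConeMap

/-- If an invariant map `p` is proper along `γ`, then so is the orbit map of `γ`. -/
theorem isProperMap_smul_of_comp {G X T : Type*} [Group G] [TopologicalSpace G] [CompactSpace G]
    [TopologicalSpace X] [T2Space X] [MulAction G X] [ContinuousSMul G X] [TopologicalSpace T]
    {B : Type*} [TopologicalSpace B] {p : X → B} (hp : Continuous p) {γ : T → X}
    (hγ : Continuous γ) (hpγ : ∀ (g : G) t, p (g • γ t) = p (γ t))
    (hpr : IsProperMap (p ∘ γ)) : IsProperMap fun q : G × T => q.1 • γ q.2 := by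
  refine isProperMap_of_comp_of_t2 (continuous_fst.smul (hγ.comp continuous_snd)) hp ?_
  have h : (p ∘ fun q : G × T => q.1 • γ q.2) = (p ∘ γ) ∘ Prod.snd := by
    ext q; exact hpγ _ _
  rw [h]
  exact hpr.comp isProperMap_snd_of_compactSpace

/-! ### Adjunction spaces -/

/-- Two closed embeddings that cover `X` and overlap exactly in the images of `S` and `S'`, where
they differ by `φ`, exhibit `X` as the adjunction space. -/
theorem Glued.exists_homeomorph {A B X : Type*} [TopologicalSpace A] [TopologicalSpace B]
    [TopologicalSpace X] {S : Set A} {S' : Set B} (φ : S → S') {i : A → X} {j : B → X}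
    (hi : IsClosedEmbedding i) (hj : IsClosedEmbedding j) (hcov : range i ∪ range j = univ)
    (hφ : ∀ s : S, i s = j (φ s)) (hover : ∀ a b, i a = j b → ∃ h : a ∈ S, φ ⟨a, h⟩ = b) :
    ∃ Θ : Glued φ ≃ₜ X, (∀ a, Θ (Glued.inl φ a) = i a) ∧ ∀ b, Θ (Glued.inr φ b) = j b := by
  let F : Glued φ → X := Quot.lift (Sum.elim i j) (by
    rintro _ _ ⟨s, rfl, rfl⟩
    exact hφ s)
  have hglue : ∀ a b, i a = j b → Glued.inl φ a = Glued.inr φ b := by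
    intro a b h
    obtain ⟨ha, rfl⟩ := hover a b h
    exact Quot.sound ⟨⟨a, ha⟩, rfl, rfl⟩
  have hF : Continuous F := continuous_quot_lift _ (hi.continuous.sumElim hj.continuous)
  have hinj : Function.Injective F := by
    rintro ⟨a | b⟩ ⟨a' | b'⟩ h
    · exact congrArg (Glued.inl φ) (hi.injective h)
    · exact hglue a b' h
    · exact (hglue a' b h.symm).symm
    · exact congrArg (Glued.inr φ) (hj.injective h)
  have hsurj : Function.Surjective F := by
    intro x
    rcases (hcov.symm ▸ mem_univ x : x ∈ range i ∪ range j) with ⟨a, rfl⟩ | ⟨b, rfl⟩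
    · exact ⟨Glued.inl φ a, rfl⟩
    · exact ⟨Glued.inr φ b, rfl⟩
  have hclosed : IsClosedMap F := by
    intro C hC
    have hmk : Continuous (Quot.mk (glueRel φ)) := continuous_quot_mk
    have h := (hi.isClosedMap _ ((hC.preimage hmk).preimage continuous_inl)).union
      (hj.isClosedMap _ ((hC.preimage hmk).preimage continuous_inr))
    convert h using 1
    ext x
    constructor
    · rintro ⟨⟨a | b⟩, hz, rfl⟩
      · exact Or.inl ⟨a, hz, rfl⟩
      · exact Or.inr ⟨b, hz, rfl⟩
    · rintro (⟨a, hz, rfl⟩ | ⟨b, hz, rfl⟩)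
      · exact ⟨_, hz, rfl⟩
      · exact ⟨_, hz, rfl⟩
  exact ⟨(Equiv.ofBijective F ⟨hinj, hsurj⟩).toHomeomorphOfContinuousClosed hF hclosed,
    fun _ => rfl, fun _ => rfl⟩

/-! ### Product decompositions along a section -/

section Section

variable {G X B : Type*} [Group G] [TopologicalSpace G] [IsTopologicalGroup G] [CompactSpace G]
  [TopologicalSpace X] [T2Space X] [MulAction G X] [ContinuousSMul G X] [TopologicalSpace B]
  {p : X → B} {H : Subgroup G}

/-- A section over `U` of the invariant map `p`, whose fibres are the orbits, with all isotropy
groups equal to `H`, identifies `U × G/H` with the part of `X` over `U`. -/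
theorem exists_homeomorph_of_section (hp : Continuous p)
    (hfib : ∀ x y, p x = p y ↔ ∃ g : G, g • x = y) {U : Set B} {γ : U → X} (hγ : Continuous γ)
    (hpγ : ∀ u, p (γ u) = u) (hH : ∀ u, MulAction.stabilizer G (γ u) = H) :
    ∃ Θ : U × (G ⧸ H) ≃ₜ p ⁻¹' U, ∀ (u : U) (g : G), (Θ (u, (g : G ⧸ H)) : X) = g • γ u := by
  have hinv : ∀ (g : G) x, p (g • x) = p x := fun g x => ((hfib x _).2 ⟨g, rfl⟩).symm
  let F : U × (G ⧸ H) → X := fun z => Quotient.liftOn' z.2 (fun g : G => g • γ z.1) (by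
    intro g g' h
    rw [QuotientGroup.leftRel_apply, ← hH z.1, MulAction.mem_stabilizer_iff] at h
    conv_lhs => rw [← h, smul_smul]
    simp)
  have hFmk : ∀ u (g : G), F (u, (g : G ⧸ H)) = g • γ u := fun _ _ => rfl
  have hF : Continuous F := by
    have hmk : IsOpenQuotientMap (Prod.map (id : U → U) (QuotientGroup.mk : G → G ⧸ H)) :=
      IsOpenQuotientMap.prodMap IsOpenQuotientMap.id QuotientGroup.isOpenQuotientMap_mk
    refine hmk.continuous_comp_iff.1 ?_
    exact continuous_snd.smul (hγ.comp continuous_fst)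
  have hpF : ∀ z, p (F z) = z.1 := by
    rintro ⟨u, y⟩
    obtain ⟨g, rfl⟩ := QuotientGroup.mk_surjective y
    rw [hFmk, hinv, hpγ]
  let F' : U × (G ⧸ H) → p ⁻¹' U := fun z => ⟨F z, by rw [mem_preimage, hpF]; exact z.1.2⟩
  have hF' : Continuous F' := hF.subtype_mk _
  have hproper : IsProperMap F' := by
    refine isProperMap_of_comp_of_t2 hF' (hp.restrictPreimage (s := U)) ?_
    have h : U.restrictPreimage p ∘ F' = Prod.fst := by
      ext z; exact hpF z
    rw [h]
    exact isProperMap_fst_of_compactSpace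
  have hbij : Function.Bijective F' := by
    constructor
    · rintro ⟨u, y⟩ ⟨u', y'⟩ h
      have h' : F (u, y) = F (u', y') := congrArg Subtype.val h
      obtain rfl : u = u' := Subtype.ext (by rw [← hpF (u, y), h', hpF])
      obtain ⟨g, rfl⟩ := QuotientGroup.mk_surjective y
      obtain ⟨g', rfl⟩ := QuotientGroup.mk_surjective y'
      rw [hFmk, hFmk] at h'
      rw [Prod.mk.injEq]
      refine ⟨rfl, QuotientGroup.eq.2 ?_⟩
      rw [← hH u, MulAction.mem_stabilizer_iff, mul_smul, ← h', inv_smul_smul]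
    · rintro ⟨x, hx⟩
      obtain ⟨g, hg⟩ := (hfib (γ ⟨p x, hx⟩) x).1 (hpγ _)
      exact ⟨(⟨p x, hx⟩, (g : G ⧸ H)), Subtype.ext hg⟩
  exact ⟨(Equiv.ofBijective F' hbij).toHomeomorphOfContinuousClosed hF' hproper.isClosedMap,
    fun _ _ => rfl⟩

end Section

/-! ### Homogeneous bundles -/

/-- A product decomposition of the part of `Z` over an open set `U` is a local trivialization. -/
theorem exists_trivialization_of_homeomorph {Z B F : Type*} [TopologicalSpace Z]
    [TopologicalSpace B] [TopologicalSpace F] {p : Z → B} (hp : Continuous p) {U : Set B}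
    (hU : IsOpen U) (Θ : U × F ≃ₜ p ⁻¹' U) (hΘ : ∀ z, p (Θ z) = z.1) (z₀ : U × F) :
    ∃ e : Bundle.Trivialization F p, e.baseSet = U ∧ ∀ u y, e (Θ (u, y)) = ((u : B), y) := by
  classical
  -- off the part over `U`, and off `U × F`, the two maps take arbitrary values
  let toF : Z → B × F := fun x => if hx : p x ∈ U then ((Θ.symm ⟨x, hx⟩).1, (Θ.symm ⟨x, hx⟩).2)
    else (z₀.1, z₀.2)
  let invF : B × F → Z := fun w => Θ (if hw : w.1 ∈ U then ⟨w.1, hw⟩ else z₀.1, w.2)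
  have htoF : ∀ z, toF (Θ z) = ((z.1 : B), z.2) := by
    intro z
    have h : p (Θ z) ∈ U := (Θ z).2
    simp only [toF, h, dite_true, Subtype.coe_eta, Homeomorph.symm_apply_apply]
  have hinvF : ∀ (u : U) y, invF (u, y) = Θ (u, y) := by
    intro u y
    simp only [invF, u.2, dite_true, Subtype.coe_eta]
  let e : Bundle.Trivialization F p :=
    { toFun := toF
      invFun := invF
      source := p ⁻¹' U
      target := U ×ˢ univ
      map_source' := fun x hx => by
        obtain ⟨z, hz⟩ := Θ.surjective ⟨x, hx⟩
        obtain rfl : (Θ z : Z) = x := congrArg Subtype.val hz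
        rw [htoF]
        exact ⟨z.1.2, mem_univ _⟩
      map_target' := fun _ _ => Subtype.coe_prop _
      left_inv' := fun x hx => by
        obtain ⟨z, hz⟩ := Θ.surjective ⟨x, hx⟩
        obtain rfl : (Θ z : Z) = x := congrArg Subtype.val hz
        rw [htoF, hinvF]
      right_inv' := fun w hw => by
        have h := htoF (⟨w.1, hw.1⟩, w.2)
        rwa [← hinvF] at h
      open_source := hU.preimage hp
      open_target := hU.prod isOpen_univ
      continuousOn_toFun := by
        refine continuousOn_iff_continuous_domRestrict.2 (((continuous_subtype_val.prodMap
          continuous_id).comp Θ.symm.continuous).congr fun x => ?_)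
        obtain ⟨z, rfl⟩ := Θ.surjective x
        rw [Function.comp_apply, Θ.symm_apply_apply]
        exact (htoF z).symm
      continuousOn_invFun := by
        refine continuousOn_iff_continuous_domRestrict.2 (((continuous_subtype_val.comp
          Θ.continuous).comp (by fun_prop : Continuous fun w : (U ×ˢ univ : Set (B × F)) =>
            ((⟨w.1.1, w.2.1⟩ : U), w.1.2))).congr fun w => ?_)
        exact (hinvF ⟨w.1.1, w.2.1⟩ w.1.2).symm
      baseSet := U
      open_baseSet := hU
      source_eq := rfl
      target_eq := rfl
      proj_toFun := fun x hx => by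
        obtain ⟨z, hz⟩ := Θ.surjective ⟨x, hx⟩
        obtain rfl : (Θ z : Z) = x := congrArg Subtype.val hz
        rw [hΘ]
        exact congrArg Prod.fst (htoF z) }
  exact ⟨e, rfl, fun u y => htoF (u, y)⟩

section

variable {G : Type*} [Group G]

theorem isClosed_normalizer [TopologicalSpace G] [IsTopologicalGroup G] {H : Subgroup G}
    (hH : IsClosed (H : Set G)) : IsClosed (Subgroup.normalizer (H : Set G) : Set G) := by
  have h : (Subgroup.normalizer (H : Set G) : Set G) =
      ⋂ h ∈ H, ({g : G | g * h * g⁻¹ ∈ H} ∩ {g : G | g⁻¹ * h * g ∈ H}) := by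
    ext g
    simp only [mem_iInter, SetLike.mem_coe, mem_inter_iff, mem_ofPred_eq]
    constructor
    · intro hg h hh
      refine ⟨(hg h).1 hh, (hg _).2 ?_⟩
      simpa [mul_assoc] using hh
    · intro hg h
      refine ⟨fun hh => (hg h hh).1, fun hh => ?_⟩
      simpa [mul_assoc] using (hg _ hh).2
  rw [h]
  refine isClosed_biInter fun h _ => IsClosed.inter ?_ ?_
  · exact hH.preimage (by fun_prop : Continuous fun g : G => g * h * g⁻¹)
  · exact hH.preimage (by fun_prop : Continuous fun g : G => g⁻¹ * h * g)

/-- The inclusion `N(H)/H → G/H`. -/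
def NormalizerQuotient.toQuotient (H : Subgroup G) : NormalizerQuotient H → G ⧸ H :=
  Quotient.map' Subtype.val fun n n' h => by
    rw [QuotientGroup.leftRel_apply] at h ⊢
    exact h

theorem NormalizerQuotient.toQuotient_mk {H : Subgroup G} (n : Subgroup.normalizer (H : Set G)) :
    toQuotient H (n : NormalizerQuotient H) = ((n : G) : G ⧸ H) := rfl

theorem NormalizerQuotient.mk_smul_mk {H : Subgroup G} (n : Subgroup.normalizer (H : Set G))
    (g : G) : (n : NormalizerQuotient H) • (g : G ⧸ H) = ((g * (n : G)⁻¹ : G) : G ⧸ H) := rfl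

variable [TopologicalSpace G] [IsTopologicalGroup G] [CompactSpace G]

theorem NormalizerQuotient.isClosedEmbedding_toQuotient {H : Subgroup G}
    (hH : IsClosed (H : Set G)) : IsClosedEmbedding (toQuotient H) := by
  have := hH
  have : CompactSpace (Subgroup.normalizer (H : Set G)) :=
    isCompact_iff_compactSpace.1 (isClosed_normalizer hH).isCompact
  refine Continuous.isClosedEmbedding ?_ ?_
  · exact Continuous.quotient_map' continuous_subtype_val _
  · intro x y h
    obtain ⟨n, rfl⟩ := QuotientGroup.mk_surjective x
    obtain ⟨n', rfl⟩ := QuotientGroup.mk_surjective y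
    rw [toQuotient_mk, toQuotient_mk, QuotientGroup.eq] at h
    exact QuotientGroup.eq.2 h

/-- An invariant map whose fibres are the orbits is a homogeneous bundle as soon as it has local
sections with isotropy group `H`: the sections differ by elements of the normalizer of `H`. -/
theorem isHomogeneousBundle_of_sections {X B : Type*} [TopologicalSpace X] [T2Space X]
    [MulAction G X] [ContinuousSMul G X] [TopologicalSpace B] {p : X → B} {H : Subgroup G}
    (hHc : IsClosed (H : Set G)) (hp : Continuous p)
    (hfib : ∀ x y, p x = p y ↔ ∃ g : G, g • x = y)
    (hsec : ∀ b, ∃ U : Set B, IsOpen U ∧ b ∈ U ∧ ∃ γ : U → X, Continuous γ ∧ (∀ u, p (γ u) = u) ∧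
      ∀ u, MulAction.stabilizer G (γ u) = H) : IsHomogeneousBundle H p := by
  have hinv : ∀ (g : G) x, p (g • x) = p x := fun g x => ((hfib x _).2 ⟨g, rfl⟩).symm
  have hloc : ∀ b, ∃ (U : Set B) (γ : U → X) (e : Bundle.Trivialization (G ⧸ H) p), b ∈ U ∧
      Continuous γ ∧ (∀ u, p (γ u) = u) ∧ (∀ u, MulAction.stabilizer G (γ u) = H) ∧
      e.baseSet = U ∧ ∀ (u : U) (g : G), e (g • γ u) = ((u : B), (g : G ⧸ H)) := by
    intro b
    obtain ⟨U, hU, hb, γ, hγ, hpγ, hH⟩ := hsec b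
    obtain ⟨Θ, hΘ⟩ := exists_homeomorph_of_section hp hfib hγ hpγ hH
    obtain ⟨e, he, heΘ⟩ := exists_trivialization_of_homeomorph hp hU Θ (by
      rintro ⟨u, y⟩
      obtain ⟨g, rfl⟩ := QuotientGroup.mk_surjective y
      rw [hΘ, hinv, hpγ]) (⟨b, hb⟩, ((1 : G) : G ⧸ H))
    exact ⟨U, γ, e, hb, hγ, hpγ, hH, he, fun u g => by rw [← hΘ, heΘ]⟩
  choose U γ e hb hγ hpγ hH he heγ using hloc
  have hex : ∀ b (u : U b) x, p x = u → ∃ g : G, g • γ b u = x := fun b u x hx =>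
    (hfib _ _).1 ((hpγ b u).trans hx.symm)
  refine ⟨e, fun b => (he b).symm ▸ hb b, fun b g x hx => ?_, fun a b => ?_⟩
  · have hx' : p x ∈ U b := by rwa [(e b).mem_source, he] at hx
    refine ⟨by rw [(e b).mem_source, he, hinv]; exact hx', ?_⟩
    obtain ⟨g', hg'⟩ := hex b ⟨p x, hx'⟩ x rfl
    rw [← hg', smul_smul, heγ, heγ]
    rfl
  · have hν : ∀ z, ∃ ν : NormalizerQuotient H, ∀ (ha : z ∈ U a) (hb : z ∈ U b),
        ∃ n : Subgroup.normalizer (H : Set G), (n : NormalizerQuotient H) = ν ∧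
          γ a ⟨z, ha⟩ = (n : G) • γ b ⟨z, hb⟩ := by
      intro z
      by_cases h : z ∈ U a ∧ z ∈ U b
      · obtain ⟨n, hn⟩ := hex b ⟨z, h.2⟩ (γ a ⟨z, h.1⟩) (hpγ a _)
        have hnN : n ∈ Subgroup.normalizer (H : Set G) := by
          intro g
          have h1 := hH a ⟨z, h.1⟩
          have h2 := hH b ⟨z, h.2⟩
          rw [SetLike.mem_coe, SetLike.mem_coe]
          conv_lhs => rw [← h2]
          conv_rhs => rw [← h1, ← hn]
          simp only [MulAction.mem_stabilizer_iff, mul_smul, inv_smul_smul]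
          exact (smul_left_cancel_iff n).symm
        exact ⟨((⟨n, hnN⟩ : Subgroup.normalizer (H : Set G)) : NormalizerQuotient H),
          fun _ _ => ⟨⟨n, hnN⟩, rfl, hn.symm⟩⟩
      · exact ⟨1, fun h1 h2 => absurd ⟨h1, h2⟩ h⟩
    choose ν hν using hν
    refine ⟨fun z => (ν z)⁻¹, ContinuousOn.inv ?_, ?_⟩
    · rw [he, he,
        (NormalizerQuotient.isClosedEmbedding_toQuotient hHc).isInducing.continuousOn_iff,
        continuousOn_iff_continuous_domRestrict]
      have h1 : Continuous fun z : (U a ∩ U b : Set B) => γ a ⟨z, z.2.1⟩ :=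
        (hγ a).comp (continuous_subtype_val.subtype_mk _)
      have hcont : ContinuousOn (e b) (e b).source := (e b).continuousOn_toFun
      have h2 : Continuous fun z : (U a ∩ U b : Set B) => e b (γ a ⟨z, z.2.1⟩) :=
        hcont.comp_continuous h1 fun z => (e b).mem_source.2 (by rw [he, hpγ]; exact z.2.2)
      refine (continuous_snd.comp h2).congr fun z => ?_
      obtain ⟨n, hn, hz⟩ := hν z z.2.1 z.2.2
      change (e b (γ a ⟨z, z.2.1⟩)).2 = NormalizerQuotient.toQuotient H (ν z)
      rw [hz, heγ, ← hn]
      rfl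
    · rintro z ⟨hza, hzb⟩ y
      rw [he] at hza hzb
      obtain ⟨g, rfl⟩ := QuotientGroup.mk_surjective y
      obtain ⟨n, hn, hz⟩ := hν z hza hzb
      have hsymm : (e a).toOpenPartialHomeomorph.symm (z, (g : G ⧸ H)) = g • γ a ⟨z, hza⟩ := by
        rw [← heγ a ⟨z, hza⟩ g]
        exact (e a).toOpenPartialHomeomorph.left_inv (by
          rw [(e a).mem_source, he, hinv, hpγ]
          exact hza)
      rw [Bundle.Trivialization.coordChange, hsymm, hz, smul_smul, heγ]
      change _ = (ν z)⁻¹ • _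
      rw [← hn, ← QuotientGroup.mk_inv, NormalizerQuotient.mk_smul_mk]
      simp

end

/-! ### Orbit spaces and their geodesic charts -/

theorem OrbitSpaceIsometry.proj_surjective {G X Y : Type*} [Group G] [MetricSpace X]
    [MulAction G X] [MetricSpace Y] (f : OrbitSpaceIsometry G X Y) :
    Function.Surjective f.proj := by
  intro b
  obtain ⟨o, rfl⟩ := f.toEquiv.surjective b
  obtain ⟨y, rfl⟩ := Quotient.exists_rep o
  exact ⟨y, rfl⟩

/-- Compactness of `G` makes the infimum in the orbital distance a minimum, and, as `G` acts by
isometries, the minimum is attained from every point of the orbit. -/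
theorem OrbitSpaceIsometry.isOrbitSubmetry {G X Y : Type*} [Group G] [TopologicalSpace G]
    [CompactSpace G] [MetricSpace X] [MulAction G X] [ContinuousSMul G X] [IsIsometricSMul G X]
    [MetricSpace Y] (f : OrbitSpaceIsometry G X Y) : IsOrbitSubmetry G f.proj := by
  have hmem : ∀ x : X, x ∈ (orbitProj G x).orbit := fun x =>
    MulAction.orbitRel.Quotient.mem_orbit.2 rfl
  have hdist : ∀ x y, dist (f.proj x) (f.proj y) = orbitDist (orbitProj G x) (orbitProj G y) :=
    fun x y => f.dist_eq' _ _
  have heq : ∀ x y : X, orbitProj G x = orbitProj G y ↔ ∃ g : G, g • x = y := by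
    intro x y
    rw [eq_comm]
    exact Quotient.eq''.trans MulAction.orbitRel_apply
  refine ⟨fun x y => (f.toEquiv.injective.eq_iff).trans (heq x y), fun x y => ?_, fun x b => ?_⟩
  · rw [hdist]
    refine ciInf_le (f := fun z : (orbitProj G x).orbit × (orbitProj G y).orbit =>
      dist (z.1 : X) (z.2 : X)) ⟨0, ?_⟩ (⟨x, hmem x⟩, ⟨y, hmem y⟩)
    rintro _ ⟨z, rfl⟩
    exact dist_nonneg
  · obtain ⟨y, rfl⟩ := f.proj_surjective b
    obtain ⟨g, -, hg⟩ := isCompact_univ.exists_isMinOn (univ_nonempty (α := G))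
      (continuous_const.dist (continuous_id.smul continuous_const) :
        Continuous fun g : G => dist x (g • y)).continuousOn
    refine ⟨g • y, congrArg f.toEquiv ((heq _ _).2 ⟨g⁻¹, inv_smul_smul _ _⟩), ?_⟩
    rw [hdist]
    refine le_antisymm ?_ ?_
    · have : Nonempty ((orbitProj G x).orbit × (orbitProj G y).orbit) :=
        ⟨(⟨x, hmem x⟩, ⟨y, hmem y⟩)⟩
      refine le_ciInf ?_
      rintro ⟨⟨z, hz⟩, ⟨w, hw⟩⟩
      obtain ⟨h, rfl⟩ := (heq _ _).1 (MulAction.orbitRel.Quotient.mem_orbit.1 hz).symm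
      obtain ⟨k, rfl⟩ := (heq _ _).1 (MulAction.orbitRel.Quotient.mem_orbit.1 hw).symm
      have h1 : dist (h • x) (k • y) = dist x ((h⁻¹ * k) • y) := by
        rw [← dist_smul h⁻¹, inv_smul_smul, mul_smul]
      exact (hg (mem_univ (h⁻¹ * k))).trans_eq h1.symm
    · refine ciInf_le (f := fun z : (orbitProj G x).orbit × (orbitProj G y).orbit =>
        dist (z.1 : X) (z.2 : X)) ⟨0, ?_⟩ (⟨x, hmem x⟩, ⟨g • y, ?_⟩)
      · rintro _ ⟨z, rfl⟩
        exact dist_nonneg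
      · exact MulAction.orbitRel.Quotient.mem_orbit.2 ((heq _ _).2 ⟨g⁻¹, inv_smul_smul _ _⟩)

/-- In a subset of the line, every segment is a segment chart. -/
theorem isSegmentChart_of_isometry {Y : Type*} [MetricSpace Y] {ι : Y → ℝ} (hι : Isometry ι)
    {c : ℝ → Y} {a b : ℝ} (hc : ∀ t ∈ Icc a b, ι (c t) = t) : IsSegmentChart c a b where
  dist_eq s hs t ht := by rw [← hι.dist_eq, hc s hs, hc t ht, Real.dist_eq]
  isOpen_image s t hs ht := by
    have h : c '' Ioo s t = ι ⁻¹' Ioo s t := by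
      ext p
      constructor
      · rintro ⟨u, hu, rfl⟩
        rwa [mem_preimage, hc u ⟨hs.trans hu.1.le, hu.2.le.trans ht⟩]
      · intro hp
        exact ⟨ι p, hp, hι.injective (hc _ ⟨hs.trans hp.1.le, hp.2.le.trans ht⟩)⟩
    rw [h]
    exact isOpen_Ioo.preimage hι.continuous
  eq_of_dist s t u p hs hst htu hu h1 h2 := by
    have ht : t ∈ Icc a b := ⟨hs.trans hst, htu.trans hu⟩
    rw [← hι.dist_eq, hc s ⟨hs, hst.trans ht.2⟩, Real.dist_eq] at h1
    rw [← hι.dist_eq, hc u ⟨ht.1.trans htu, hu⟩, Real.dist_eq] at h2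
    refine hι.injective ?_
    rw [hc t ht]
    rcases abs_cases (s - ι p) with ⟨h3, -⟩ | ⟨h3, -⟩ <;>
    rcases abs_cases (ι p - u) with ⟨h4, -⟩ | ⟨h4, -⟩ <;> linarith

/-- Arcs shorter than half of the circle are segment charts; between antipodal points geodesics
are not unique. -/
theorem isSegmentChart_addCircle {a b : ℝ} (hab : b - a < Real.pi) :
    IsSegmentChart (fun t : ℝ => (t : AddCircle (2 * Real.pi))) a b := by
  have hπ := Real.pi_pos
  have hdist : ∀ s t : ℝ, |s - t| ≤ Real.pi →
      dist (s : AddCircle (2 * Real.pi)) (t : AddCircle (2 * Real.pi)) = |s - t| := by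
    intro s t h
    have hp : 2 * Real.pi ≠ 0 := by positivity
    have hp' : |s - t| ≤ |2 * Real.pi| / 2 := by
      rw [abs_of_pos (by positivity : 0 < 2 * Real.pi)]
      linarith
    rw [dist_eq_norm, ← AddCircle.coe_sub]
    exact (AddCircle.norm_coe_eq_abs_iff _ hp).2 hp'
  refine ⟨fun s hs t ht => hdist s t (abs_le.2 ?_), fun s t _ _ => ?_, ?_⟩
  · constructor <;> linarith [hs.1, hs.2, ht.1, ht.2]
  · exact QuotientAddGroup.isOpenMap_coe _ isOpen_Ioo
  · intro s t u p hs hst htu hu h1 h2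
    have : Fact (0 < 2 * Real.pi) := ⟨by positivity⟩
    obtain ⟨r, hr, rfl⟩ : ∃ r ∈ Ioc (s - Real.pi) (s - Real.pi + 2 * Real.pi),
        (r : AddCircle (2 * Real.pi)) = p :=
      ⟨_, (AddCircle.equivIoc (2 * Real.pi) (s - Real.pi) p).2, AddCircle.coe_equivIoc⟩
    rw [hdist s r (abs_le.2 ⟨by linarith [hr.2], by linarith [hr.1]⟩)] at h1
    rcases abs_cases (s - r) with ⟨h3, -⟩ | ⟨h3, -⟩
    · -- here `r` is the reflection of `t` in `s`
      obtain rfl : r = 2 * s - t := by linarith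
      by_cases h : u + t - 2 * s ≤ Real.pi
      · rw [hdist _ _ (abs_le.2 ⟨by linarith, by linarith⟩), abs_of_nonpos (by linarith)] at h2
        congr 1
        linarith
      · have hper : ((2 * s - t : ℝ) : AddCircle (2 * Real.pi)) =
            ((2 * s - t + 2 * Real.pi : ℝ) : AddCircle (2 * Real.pi)) :=
          (AddCircle.coe_add_period _ _).symm
        rw [hper, hdist _ _ (abs_le.2 ⟨by linarith, by linarith⟩), abs_of_nonneg (by linarith)]
          at h2
        linarith
    · congr 1
      linarith

/-! ### The four orbit spaces -/

/-- In a cone bundle that embeds in `X` by `[g,[kH,t]] ↦ g • k • γ t`, the boundary consists of the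
points over the end of `γ`. -/
theorem ConeBundle.mem_boundary_iff {G X Y : Type*} [Group G] [MulAction G X] {p : X → Y}
    (hfib : ∀ x y, p x = p y ↔ ∃ g : G, g • x = y)
    {K H : Subgroup G} {γ : I → X} (hH : ∀ t, H ≤ MulAction.stabilizer G (γ t))
    (hK : K ≤ MulAction.stabilizer G (γ 0)) (hpγ : Function.Injective (p ∘ γ))
    (z : ConeBundle I K H) :
    z ∈ ConeBundle.boundary K H ↔ p (coneBundleMap hH hK z) = p (γ 1) := by
  have hinv : ∀ (g : G) x, p (g • x) = p x := fun g x => ((hfib x _).2 ⟨g, rfl⟩).symm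
  constructor
  · rintro ⟨g, y, rfl⟩
    obtain ⟨k, rfl⟩ := QuotientGroup.mk_surjective y
    rw [coneBundleMap_mk, hinv]
  · intro h
    obtain ⟨g, t, rfl⟩ := z.exists_eq_mk
    rw [coneBundleMap_mk_one, hinv] at h
    exact ⟨g, _, by rw [hpγ h]⟩

theorem coneBundleMap_image_boundary {G X Y : Type*} [Group G] [MulAction G X] {p : X → Y}
    (hfib : ∀ x y, p x = p y ↔ ∃ g : G, g • x = y)
    {K H : Subgroup G} {γ : I → X} (hH : ∀ t, H ≤ MulAction.stabilizer G (γ t))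
    (hK : K ≤ MulAction.stabilizer G (γ 0)) (hpγ : Function.Injective (p ∘ γ)) :
    coneBundleMap hH hK '' ConeBundle.boundary K H = p ⁻¹' {p (γ 1)} := by
  ext x
  constructor
  · rintro ⟨z, hz, rfl⟩
    exact (ConeBundle.mem_boundary_iff hfib hH hK hpγ z).1 hz
  · intro hx
    obtain ⟨g, rfl⟩ := (hfib (γ 1) x).1 (mem_singleton_iff.1 hx).symm
    exact ⟨_, ⟨g, _, rfl⟩, coneBundleMap_mk_one g 1⟩

theorem Topology.IsEmbedding.exists_homeomorph_of_image_eq {A B X : Type*} [TopologicalSpace A]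
    [TopologicalSpace B] [TopologicalSpace X] {i : A → X} {j : B → X} (hi : IsEmbedding i)
    (hj : IsEmbedding j) {S : Set A} {S' : Set B} (h : i '' S = j '' S') :
    ∃ φ : S ≃ₜ S', ∀ s, j (φ s) = i s := by
  refine ⟨((hi.homeomorphImage S).trans (Homeomorph.setCongr h)).trans
    (hj.homeomorphImage S').symm, fun s => ?_⟩
  exact congrArg Subtype.val ((hj.homeomorphImage S').apply_symm_apply
    (Homeomorph.setCongr h (hi.homeomorphImage S s)))

section

variable {G X : Type*} [Group G] [TopologicalSpace G] [IsTopologicalGroup G] [CompactSpace G]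
  [MetricSpace X] [SecondCountableTopology X] [MeasurableSpace X] [BorelSpace X]
  [MulAction G X] [ContinuousSMul G X] [IsIsometricSMul G X]

/-- Over the line, a horizontal geodesic through `x₀` is a global section. -/
theorem exists_homeomorph_of_line (m : Measure X) [m.IsOpenPosMeasure]
    (hm : ∀ (x : X) (r : ℝ), m (Metric.ball x r) < ∞) (hgeo : IsGeodesicSpace X)
    (hnb : IsEssentiallyNonbranching m) [SMulInvariantMeasure G X m]
    (f : OrbitSpaceIsometry G X ℝ) (x₀ : X) :
    ∃ Θ : ℝ × (G ⧸ MulAction.stabilizer G x₀) ≃ₜ X,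
      (∀ (g : G) (t : ℝ) (y : G ⧸ MulAction.stabilizer G x₀), Θ (t, g • y) = g • Θ (t, y)) ∧
      ∀ (t : ℝ) (y : G ⧸ MulAction.stabilizer G x₀), f.proj (Θ (t, y)) = t := by
  have hq := f.isOrbitSubmetry
  have hint : ∀ t : ℝ, (∃ a ∈ (univ : Set ℝ), a < t) ∧ ∃ b ∈ (univ : Set ℝ), t < b := fun t =>
    ⟨⟨t - 1, mem_univ _, by linarith⟩, t + 1, mem_univ _, by linarith⟩
  obtain ⟨γ, hγ, hqγ, -, hstab, -⟩ := hnb.exists_section m hm hgeo hq (c := id) (J := univ)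
    (fun a _ b _ => isSegmentChart_of_isometry isometry_id fun _ _ => rfl)
    (mem_univ (f.proj x₀)) (hint _) rfl
  obtain ⟨Θ, hΘ⟩ := exists_homeomorph_of_section hq.continuous hq.eq_iff hγ.continuous hqγ
    (fun t => hstab t (hint t))
  let e : ℝ × (G ⧸ MulAction.stabilizer G x₀) ≃ₜ X :=
    (((Homeomorph.Set.univ ℝ).symm.prodCongr (Homeomorph.refl _)).trans Θ).trans
      (Homeomorph.Set.univ X)
  have he : ∀ (t : ℝ) (g : G), e (t, (g : G ⧸ MulAction.stabilizer G x₀)) =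
      g • γ ⟨t, mem_univ t⟩ := fun t g => hΘ ⟨t, mem_univ t⟩ g
  refine ⟨e, fun g t y => ?_, fun t y => ?_⟩
  · obtain ⟨g', rfl⟩ := QuotientGroup.mk_surjective y
    rw [he, smul_smul, ← he]
    rfl
  · obtain ⟨g', rfl⟩ := QuotientGroup.mk_surjective y
    rw [he, hq.map_smul, hqγ]
    rfl

/-- Over the circle, horizontal geodesics over short arcs are local sections. -/
theorem isHomogeneousBundle_of_circle (m : Measure X) [m.IsOpenPosMeasure]
    (hm : ∀ (x : X) (r : ℝ), m (Metric.ball x r) < ∞) (hgeo : IsGeodesicSpace X)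
    (hnb : IsEssentiallyNonbranching m) [SMulInvariantMeasure G X m]
    (f : OrbitSpaceIsometry G X (AddCircle (2 * Real.pi))) (x₀ : X) :
    IsHomogeneousBundle (MulAction.stabilizer G x₀) f.proj := by
  have hq := f.isOrbitSubmetry
  have hπ := Real.pi_gt_three
  let c : ℝ → AddCircle (2 * Real.pi) := fun t => t
  -- sections over the arcs of radius `3/2`, which is less than `π/2`
  have harc : ∀ (β : ℝ) (x : X), f.proj x = c β →
      ∃ γ : Ioo (β - 3 / 2) (β + 3 / 2) → X, Isometry γ ∧ (∀ t, f.proj (γ t) = c t) ∧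
        ∀ t, MulAction.stabilizer G (γ t) = MulAction.stabilizer G x := by
    intro β x hx
    have hint : ∀ t ∈ Ioo (β - 3 / 2) (β + 3 / 2), (∃ a ∈ Ioo (β - 3 / 2) (β + 3 / 2), a < t) ∧
        ∃ b ∈ Ioo (β - 3 / 2) (β + 3 / 2), t < b := by
      intro t ht
      obtain ⟨a, ha, hat⟩ := exists_between ht.1
      obtain ⟨b, htb, hb⟩ := exists_between ht.2
      exact ⟨⟨a, ⟨ha, hat.trans ht.2⟩, hat⟩, b, ⟨ht.1.trans htb, hb⟩, htb⟩
    have hβ : β ∈ Ioo (β - 3 / 2) (β + 3 / 2) := ⟨by linarith, by linarith⟩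
    obtain ⟨γ, hγ, hqγ, -, hstab, -⟩ := hnb.exists_section m hm hgeo hq (c := c)
      (J := Ioo (β - 3 / 2) (β + 3 / 2))
      (fun a ha b hb => isSegmentChart_addCircle (by linarith [ha.1, hb.2])) hβ (hint β hβ) hx
    exact ⟨γ, hγ, hqγ, fun t => hstab t (hint t t.2)⟩
  -- the isotropy group of `x₀` occurs on every orbit: move along the circle in steps of length 1
  have hocc : ∀ t : ℝ, ∃ x, f.proj x = c t ∧
      MulAction.stabilizer G x = MulAction.stabilizer G x₀ := by
    obtain ⟨t₀, ht₀⟩ := QuotientAddGroup.mk_surjective (f.proj x₀)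
    have hn : ∀ (n : ℕ) (t : ℝ), |t - t₀| ≤ n → ∃ x, f.proj x = c t ∧
        MulAction.stabilizer G x = MulAction.stabilizer G x₀ := by
      intro n
      induction n with
      | zero =>
        intro t ht
        have h : t - t₀ = 0 := abs_nonpos_iff.1 (by simpa using ht)
        obtain rfl : t = t₀ := by linarith
        exact ⟨x₀, ht₀.symm, rfl⟩
      | succ n ih =>
        intro t ht
        push_cast at ht
        obtain ⟨s, hs, hst⟩ : ∃ s, |s - t₀| ≤ n ∧ |t - s| ≤ 1 := by
          have hn0 : (0 : ℝ) ≤ n := Nat.cast_nonneg n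
          have ht' := abs_le.1 ht
          rcases le_total 0 (t - t₀) with h | h
          · refine ⟨max t₀ (t - 1), abs_le.2 ⟨?_, ?_⟩, abs_le.2 ⟨?_, ?_⟩⟩ <;>
            rcases max_cases t₀ (t - 1) with ⟨h', -⟩ | ⟨h', -⟩ <;> rw [h'] <;> grind
          · refine ⟨min t₀ (t + 1), abs_le.2 ⟨?_, ?_⟩, abs_le.2 ⟨?_, ?_⟩⟩ <;>
            rcases min_cases t₀ (t + 1) with ⟨h', -⟩ | ⟨h', -⟩ <;> rw [h'] <;> grind
        obtain ⟨x, hx, hxs⟩ := ih s hs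
        obtain ⟨γ, -, hqγ, hγs⟩ := harc s x hx
        have hst' := abs_le.1 hst
        exact ⟨γ ⟨t, by linarith, by linarith⟩, hqγ _, (hγs _).trans hxs⟩
    intro t
    obtain ⟨n, hn'⟩ := exists_nat_ge |t - t₀|
    exact hn n t hn'
  refine isHomogeneousBundle_of_sections (isClosed_stabilizer G x₀) hq.continuous hq.eq_iff
    fun b => ?_
  obtain ⟨β, rfl⟩ := QuotientAddGroup.mk_surjective b
  obtain ⟨x, hx, hxs⟩ := hocc β
  obtain ⟨γ, hγ, hqγ, hγs⟩ := harc β x hx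
  have hiso : Isometry fun t : Ioo (β - 3 / 2) (β + 3 / 2) => c t := by
    refine Isometry.of_dist_eq fun s t => ?_
    have hs := s.2
    have ht := t.2
    have hmin := min_le_left (s : ℝ) t
    have hmin' := min_le_right (s : ℝ) t
    have hmax := le_max_left (s : ℝ) t
    have hmax' := le_max_right (s : ℝ) t
    refine (isSegmentChart_addCircle (a := min s t) (b := max s t) ?_).dist_eq s ⟨hmin, hmax⟩ t
      ⟨hmin', hmax'⟩
    have h1 : β - 3 / 2 < min (s : ℝ) t := lt_min hs.1 ht.1
    have h2 : max (s : ℝ) t < β + 3 / 2 := max_lt hs.2 ht.2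
    linarith
  let e := hiso.isEmbedding.toHomeomorph
  refine ⟨range fun t : Ioo (β - 3 / 2) (β + 3 / 2) => c t, ?_,
    ⟨⟨β, by linarith, by linarith⟩, rfl⟩, fun u => γ (e.symm u),
    hγ.continuous.comp e.symm.continuous, fun u => ?_, fun u => (hγs _).trans hxs⟩
  · rw [← image_eq_range]
    exact QuotientAddGroup.isOpenMap_coe _ isOpen_Ioo
  · rw [hqγ]
    exact congrArg Subtype.val (e.apply_symm_apply u)

/-- Over the ray, the isotropy group along a horizontal geodesic can jump at the end only. -/
theorem exists_homeomorph_of_ray (m : Measure X) [m.IsOpenPosMeasure]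
    (hm : ∀ (x : X) (r : ℝ), m (Metric.ball x r) < ∞) (hgeo : IsGeodesicSpace X)
    (hnb : IsEssentiallyNonbranching m) [SMulInvariantMeasure G X m]
    (f : OrbitSpaceIsometry G X (Ici (0 : ℝ))) :
    ∃ x₁ x₀ : X, (f.proj x₁ : ℝ) = 0 ∧ 0 < (f.proj x₀ : ℝ) ∧
      ∃ K H : Subgroup G, K = MulAction.stabilizer G x₁ ∧ H = MulAction.stabilizer G x₀ ∧ H ≤ K ∧
      ∃ Θ : ConeBundle ℝ≥0 K H ≃ₜ X,
        (∀ (g : G) (z : ConeBundle ℝ≥0 K H), Θ (g • z) = g • Θ z) ∧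
        (∀ (g : G) (y : K ⧸ H.subgroupOf K), Θ (ConeBundle.mk K H g y 0) = g • x₁) := by
  have hq := f.isOrbitSubmetry
  let c : ℝ → Ici (0 : ℝ) := fun t => ⟨max 0 t, le_max_left 0 t⟩
  have hc : ∀ t, 0 ≤ t → (c t : ℝ) = t := fun t ht => max_eq_right ht
  obtain ⟨x₀, hx₀⟩ := f.proj_surjective (c 1)
  have hint : ∀ t : ℝ, 0 < t → (∃ a ∈ Ici (0 : ℝ), a < t) ∧ ∃ b ∈ Ici (0 : ℝ), t < b :=
    fun t ht => ⟨⟨0, self_mem_Ici, ht⟩, t + 1, by simpa using by linarith, by linarith⟩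
  obtain ⟨γ, hγ, hqγ, -, hstab, hle⟩ := hnb.exists_section m hm hgeo hq (c := c) (J := Ici 0)
    (fun a ha b _ => isSegmentChart_of_isometry isometry_subtype_coe
      fun t ht => hc t ((mem_Ici.1 ha).trans ht.1))
    (mem_Ici.2 zero_le_one) (hint 1 one_pos) hx₀
  let γ' : ℝ≥0 → X := fun t => γ ⟨t, t.2⟩
  have hγ' : Continuous γ' := hγ.continuous.comp (by fun_prop)
  have hqγ' : ∀ t : ℝ≥0, (f.proj (γ' t) : ℝ) = t := fun t => by rw [hqγ]; exact hc t t.2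
  let e : ℝ≥0 ≃ₜ Ici (0 : ℝ) :=
    { toFun := fun t => ⟨t, t.2⟩
      invFun := fun t => ⟨t, t.2⟩
      left_inv := fun _ => rfl
      right_inv := fun _ => rfl
      continuous_toFun := by fun_prop
      continuous_invFun := by fun_prop }
  have hcomp : f.proj ∘ γ' = e := funext fun t => Subtype.ext (hqγ' t)
  let K := MulAction.stabilizer G (γ' 0)
  let H := MulAction.stabilizer G x₀
  have hH : ∀ t, H ≤ MulAction.stabilizer G (γ' t) := fun t => hle _
  have hemb := isClosedEmbedding_coneBundleMap (hH := hH) (hK := le_refl K) hγ'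
    (fun t ht => (hstab ⟨t, t.2⟩ (hint t (NNReal.coe_pos.2 (pos_iff_ne_zero.2 ht)))).le) le_rfl
    (fun g s t h => NNReal.coe_injective (by rw [← hqγ', ← hqγ', ← h, hq.map_smul]))
    (isProperMap_smul_of_comp hq.continuous hγ' (fun g t => hq.map_smul g _)
      (hcomp ▸ e.isProperMap)).isClosedMap
  have hsurj : Function.Surjective (coneBundleMap hH (le_refl K)) := by
    intro x
    obtain ⟨g, hg⟩ := (hq.eq_iff (γ' (e.symm (f.proj x))) x).1
      ((congrFun hcomp _).trans (e.apply_symm_apply _))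
    exact ⟨_, (coneBundleMap_mk_one g _).trans hg⟩
  refine ⟨γ' 0, x₀, hqγ' 0, ?_, K, H, rfl, rfl, hH 0,
    (Equiv.ofBijective _ ⟨hemb.injective, hsurj⟩).toHomeomorphOfContinuousClosed hemb.continuous
      hemb.isClosedMap, coneBundleMap_smul, fun g y => ?_⟩
  · rw [hx₀, hc 1 zero_le_one]
    exact one_pos
  · rw [ConeBundle.mk_zero g y ((1 : K) : K ⧸ H.subgroupOf K)]
    exact coneBundleMap_mk_one g 0

/-- Over the segment, each half of a horizontal geodesic gives a cone bundle, and the two are glued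
along the orbit over `0`. -/
theorem exists_glued_homeomorph_of_segment (m : Measure X) [m.IsOpenPosMeasure]
    (hm : ∀ (x : X) (r : ℝ), m (Metric.ball x r) < ∞) (hgeo : IsGeodesicSpace X)
    (hnb : IsEssentiallyNonbranching m) [SMulInvariantMeasure G X m]
    (f : OrbitSpaceIsometry G X (Icc (-1 : ℝ) 1)) :
    ∃ x₁ x₂ x₀ : X, (f.proj x₁ : ℝ) = -1 ∧ (f.proj x₂ : ℝ) = 1 ∧ (f.proj x₀ : ℝ) = 0 ∧
      ∃ K₁ K₂ H : Subgroup G, K₁ = MulAction.stabilizer G x₁ ∧ K₂ = MulAction.stabilizer G x₂ ∧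
        H = MulAction.stabilizer G x₀ ∧ H ≤ K₁ ∧ H ≤ K₂ ∧
      ∃ φ : ConeBundle.boundary K₁ H ≃ₜ ConeBundle.boundary K₂ H,
        (∀ (g : G) (b b' : ConeBundle.boundary K₁ H),
          (b' : ConeBundle I K₁ H) = g • (b : ConeBundle I K₁ H) →
          (φ b' : ConeBundle I K₂ H) = g • (φ b : ConeBundle I K₂ H)) ∧
      ∃ Θ : Glued φ ≃ₜ X,
        (∀ (g : G) (z : ConeBundle I K₁ H),
          Θ (Glued.inl φ (g • z)) = g • Θ (Glued.inl φ z)) ∧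
        (∀ (g : G) (z : ConeBundle I K₂ H),
          Θ (Glued.inr φ (g • z)) = g • Θ (Glued.inr φ z)) ∧
        (∀ (g : G) (y : K₁ ⧸ H.subgroupOf K₁),
          Θ (Glued.inl φ (ConeBundle.mk K₁ H g y 0)) = g • x₁) ∧
        (∀ (g : G) (y : K₂ ⧸ H.subgroupOf K₂),
          Θ (Glued.inr φ (ConeBundle.mk K₂ H g y 0)) = g • x₂) := by
  have hq := f.isOrbitSubmetry
  let c : ℝ → Icc (-1 : ℝ) 1 := projIcc (-1) 1 (by norm_num)
  have hc : ∀ t ∈ Icc (-1 : ℝ) 1, (c t : ℝ) = t := fun t ht => by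
    simp only [c, projIcc_of_mem _ ht]
  have h0 : (0 : ℝ) ∈ Icc (-1 : ℝ) 1 := by norm_num
  obtain ⟨x₀, hx₀⟩ := f.proj_surjective (c 0)
  have hint : ∀ t : ℝ, -1 < t → t < 1 →
      (∃ a ∈ Icc (-1 : ℝ) 1, a < t) ∧ ∃ b ∈ Icc (-1 : ℝ) 1, t < b :=
    fun t ht ht' => ⟨⟨-1, by norm_num, ht⟩, 1, by norm_num, ht'⟩
  obtain ⟨γ, hγ, hqγ, -, hstab, hle⟩ := hnb.exists_section m hm hgeo hq (c := c)
    (J := Icc (-1) 1) (fun a ha b hb => isSegmentChart_of_isometry isometry_subtype_coe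
      fun t ht => hc t ⟨ha.1.trans ht.1, ht.2.trans hb.2⟩)
    h0 (hint 0 (by norm_num) (by norm_num)) hx₀
  have hqγ' : ∀ t, (f.proj (γ t) : ℝ) = t := fun t => by rw [hqγ, hc t t.2]
  -- the two halves of `γ`, both parametrized from the end towards the middle
  let γ₁ : I → X := fun t => γ ⟨t - 1, by linarith [t.2.1], by linarith [t.2.2]⟩
  let γ₂ : I → X := fun t => γ ⟨1 - t, by linarith [t.2.2], by linarith [t.2.1]⟩
  have hγ₁ : Continuous γ₁ := hγ.continuous.comp (by fun_prop)
  have hγ₂ : Continuous γ₂ := hγ.continuous.comp (by fun_prop)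
  have hq₁ : ∀ t : I, (f.proj (γ₁ t) : ℝ) = t - 1 := fun t => hqγ' _
  have hq₂ : ∀ t : I, (f.proj (γ₂ t) : ℝ) = 1 - t := fun t => hqγ' _
  have hinj₁ : Function.Injective (f.proj ∘ γ₁) := fun s t h => by
    have h' : (f.proj (γ₁ s) : ℝ) = f.proj (γ₁ t) := congrArg Subtype.val h
    rw [hq₁, hq₁] at h'
    exact Subtype.ext (by linarith)
  have hinj₂ : Function.Injective (f.proj ∘ γ₂) := fun s t h => by
    have h' : (f.proj (γ₂ s) : ℝ) = f.proj (γ₂ t) := congrArg Subtype.val h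
    rw [hq₂, hq₂] at h'
    exact Subtype.ext (by linarith)
  have horb : ∀ {δ : I → X}, Function.Injective (f.proj ∘ δ) →
      ∀ (g : G) s t, g • δ s = δ t → s = t := fun hδ g s t h =>
    hδ ((hq.eq_iff _ _).2 ⟨g, h⟩)
  have hmid : γ₁ 1 = γ₂ 1 := congrArg γ (Subtype.ext (by simp))
  let K₁ := MulAction.stabilizer G (γ₁ 0)
  let K₂ := MulAction.stabilizer G (γ₂ 0)
  let H := MulAction.stabilizer G x₀
  have hH₁ : ∀ t, H ≤ MulAction.stabilizer G (γ₁ t) := fun t => hle _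
  have hH₂ : ∀ t, H ≤ MulAction.stabilizer G (γ₂ t) := fun t => hle _
  have hpos : ∀ t : I, t ≠ 0 → (0 : ℝ) < t := fun t ht =>
    lt_of_le_of_ne t.2.1 fun h => ht (Subtype.ext h.symm)
  have hi := isClosedEmbedding_coneBundleMap (hH := hH₁) (hK := le_refl K₁) hγ₁
    (fun t ht => (hstab _ (hint _ (by linarith [hpos t ht]) (by linarith [t.2.2]))).le) le_rfl
    (horb hinj₁) (continuous_fst.smul (hγ₁.comp continuous_snd)).isClosedMap
  have hj := isClosedEmbedding_coneBundleMap (hH := hH₂) (hK := le_refl K₂) hγ₂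
    (fun t ht => (hstab _ (hint _ (by linarith [t.2.2]) (by linarith [hpos t ht]))).le) le_rfl
    (horb hinj₂) (continuous_fst.smul (hγ₂.comp continuous_snd)).isClosedMap
  obtain ⟨φ, hφ⟩ := hi.isEmbedding.exists_homeomorph_of_image_eq hj.isEmbedding
    (S := ConeBundle.boundary K₁ H) (S' := ConeBundle.boundary K₂ H) (by
      rw [coneBundleMap_image_boundary hq.eq_iff _ _ hinj₁,
        coneBundleMap_image_boundary hq.eq_iff _ _ hinj₂, hmid])
  have hcov : range (coneBundleMap hH₁ (le_refl K₁)) ∪ range (coneBundleMap hH₂ (le_refl K₂)) =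
      univ := by
    refine eq_univ_of_forall fun x => ?_
    obtain ⟨g, hg⟩ := (hq.eq_iff (γ (f.proj x)) x).1 (Subtype.ext (hqγ' _))
    rcases le_total ((f.proj x : ℝ)) 0 with h | h
    · refine Or.inl ⟨ConeBundle.mk K₁ H g ((1 : K₁) : K₁ ⧸ H.subgroupOf K₁)
        ⟨f.proj x + 1, by linarith [(f.proj x).2.1], by linarith⟩, ?_⟩
      rw [coneBundleMap_mk_one]
      exact (congrArg (fun t => g • γ t) (Subtype.ext (by simp))).trans hg
    · refine Or.inr ⟨ConeBundle.mk K₂ H g ((1 : K₂) : K₂ ⧸ H.subgroupOf K₂)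
        ⟨1 - f.proj x, by linarith [(f.proj x).2.2], by linarith⟩, ?_⟩
      rw [coneBundleMap_mk_one]
      exact (congrArg (fun t => g • γ t) (Subtype.ext (by simp))).trans hg
  have hover : ∀ a b, coneBundleMap hH₁ (le_refl K₁) a = coneBundleMap hH₂ (le_refl K₂) b →
      ∃ h : a ∈ ConeBundle.boundary K₁ H, φ ⟨a, h⟩ = b := by
    intro a b hab
    have ha : a ∈ ConeBundle.boundary K₁ H := by
      rw [ConeBundle.mem_boundary_iff hq.eq_iff hH₁ (le_refl K₁) hinj₁]
      -- the two halves of `[-1,1]` meet in `0` only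
      obtain ⟨g, s, rfl⟩ := a.exists_eq_mk
      obtain ⟨g', t, rfl⟩ := b.exists_eq_mk
      rw [coneBundleMap_mk_one, coneBundleMap_mk_one] at hab
      have h := congrArg (fun x => (f.proj x : ℝ)) hab
      simp only [hq.map_smul, hq₁, hq₂] at h
      have hs : s = 1 := Subtype.ext (by
        have h1 := s.2.2
        have h2 := t.2.2
        change (s : ℝ) = 1
        linarith)
      rw [coneBundleMap_mk_one, hq.map_smul, hs]
    exact ⟨ha, hj.injective ((hφ ⟨a, ha⟩).trans hab)⟩
  obtain ⟨Θ, hΘl, hΘr⟩ := Glued.exists_homeomorph φ hi hj hcov (fun s => (hφ s).symm) hover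
  refine ⟨γ₁ 0, γ₂ 0, x₀, by simp [hq₁], by simp [hq₂], by rw [hx₀, hc 0 h0], K₁, K₂, H, rfl, rfl,
    rfl, hH₁ 0, hH₂ 0, φ, fun g b b' hb => hj.injective ?_, Θ, fun g z => ?_, fun g z => ?_,
    fun g y => ?_, fun g y => ?_⟩
  · rw [hφ, hb, coneBundleMap_smul, coneBundleMap_smul, hφ]
  · rw [hΘl, hΘl, coneBundleMap_smul]
  · rw [hΘr, hΘr, coneBundleMap_smul]
  · rw [hΘl, ConeBundle.mk_zero g y ((1 : K₁) : K₁ ⧸ H.subgroupOf K₁), coneBundleMap_mk_one]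
  · rw [hΘr, ConeBundle.mk_zero g y ((1 : K₂) : K₂ ⧸ H.subgroupOf K₂), coneBundleMap_mk_one]

end

theorem theoremT {G X : Type*}
    [Group G] [TopologicalSpace G] [IsTopologicalGroup G] [CompactSpace G] [T2Space G]
    [MetricSpace X] [CompleteSpace X] [TopologicalSpace.SeparableSpace X]
    [MeasurableSpace X] [BorelSpace X]
    (m : Measure X) [m.IsOpenPosMeasure] (hm : ∀ (x : X) (r : ℝ), m (Metric.ball x r) < ∞)
    (hgeo : IsGeodesicSpace X) (hnb : IsEssentiallyNonbranching m)
    [MulAction G X] [ContinuousSMul G X] [IsIsometricSMul G X] [SMulInvariantMeasure G X m] :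
    -- orbit space `[-1,1]`: two cone bundles over the end orbits, glued along their boundary
    (∀ f : OrbitSpaceIsometry G X (Icc (-1 : ℝ) 1),
      ∃ x₁ x₂ x₀ : X, (f.proj x₁ : ℝ) = -1 ∧ (f.proj x₂ : ℝ) = 1 ∧ (f.proj x₀ : ℝ) = 0 ∧
      ∃ K₁ K₂ H : Subgroup G, K₁ = MulAction.stabilizer G x₁ ∧ K₂ = MulAction.stabilizer G x₂ ∧
        H = MulAction.stabilizer G x₀ ∧ H ≤ K₁ ∧ H ≤ K₂ ∧
      ∃ φ : ConeBundle.boundary K₁ H ≃ₜ ConeBundle.boundary K₂ H,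
        (∀ (g : G) (b b' : ConeBundle.boundary K₁ H),
          (b' : ConeBundle I K₁ H) = g • (b : ConeBundle I K₁ H) →
          (φ b' : ConeBundle I K₂ H) = g • (φ b : ConeBundle I K₂ H)) ∧
      ∃ Θ : Glued φ ≃ₜ X,
        (∀ (g : G) (z : ConeBundle I K₁ H),
          Θ (Glued.inl φ (g • z)) = g • Θ (Glued.inl φ z)) ∧
        (∀ (g : G) (z : ConeBundle I K₂ H),
          Θ (Glued.inr φ (g • z)) = g • Θ (Glued.inr φ z)) ∧
        (∀ (g : G) (y : K₁ ⧸ H.subgroupOf K₁),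
          Θ (Glued.inl φ (ConeBundle.mk K₁ H g y 0)) = g • x₁) ∧
        (∀ (g : G) (y : K₂ ⧸ H.subgroupOf K₂),
          Θ (Glued.inr φ (ConeBundle.mk K₂ H g y 0)) = g • x₂)) ∧
    -- orbit space `[0,∞)`: one cone bundle over the end orbit
    (∀ f : OrbitSpaceIsometry G X (Ici (0 : ℝ)),
      ∃ x₁ x₀ : X, (f.proj x₁ : ℝ) = 0 ∧ 0 < (f.proj x₀ : ℝ) ∧
      ∃ K H : Subgroup G, K = MulAction.stabilizer G x₁ ∧ H = MulAction.stabilizer G x₀ ∧ H ≤ K ∧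
      ∃ Θ : ConeBundle ℝ≥0 K H ≃ₜ X,
        (∀ (g : G) (z : ConeBundle ℝ≥0 K H), Θ (g • z) = g • Θ z) ∧
        (∀ (g : G) (y : K ⧸ H.subgroupOf K), Θ (ConeBundle.mk K H g y 0) = g • x₁)) ∧
    -- orbit space the circle of length `2π` with its arc length distance
    (∀ f : OrbitSpaceIsometry G X (AddCircle (2 * Real.pi)), ∀ x₀ : X,
      IsHomogeneousBundle (MulAction.stabilizer G x₀) f.proj) ∧
    -- orbit space the line
    (∀ f : OrbitSpaceIsometry G X ℝ, ∀ x₀ : X,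
      ∃ Θ : ℝ × (G ⧸ MulAction.stabilizer G x₀) ≃ₜ X,
        (∀ (g : G) (t : ℝ) (y : G ⧸ MulAction.stabilizer G x₀), Θ (t, g • y) = g • Θ (t, y)) ∧
        ∀ (t : ℝ) (y : G ⧸ MulAction.stabilizer G x₀), f.proj (Θ (t, y)) = t) := by
  have : SecondCountableTopology X := UniformSpace.secondCountable_of_separable X
  exact ⟨exists_glued_homeomorph_of_segment m hm hgeo hnb, exists_homeomorph_of_ray m hm hgeo hnb,
    isHomogeneousBundle_of_circle m hm hgeo hnb, exists_homeomorph_of_line m hm hgeo hnb⟩
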